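/- Let $\mathcal C$ be a small category and $R:\mathcal C\to\mathrm{Ring}$ a functor to (not necessarily commutative) unital rings. For $\alpha:c\to d$ in $\mathcal C$ write $\alpha_!=-\otimes_{R_c}R_d$ and $\alpha^*$ for extension and restriction of scalars between right modules along $R_\alpha:R_c\to R_d$. A right $R$-module $M$ consists of a right $R_c$-module $M_c$ for each object $c$ and an $R_c$-linear map $M_\alpha:M_c\to\alpha^*M_d$ for each $\alpha:c\to d$, with $M_{\beta\alpha}=\alpha^*(M_\beta)\circ M_\alpha$ and $M_{\mathrm{id}_c}=\mathrm{id}$. A morphism $M\to N$ is a family of $R_c$-linear maps $M_c\to N_c$ compatible with the structure maps. $M$ is cartesian if for every $\alpha:c\to d$ the adjoint map $\alpha_!M_c\to M_d$ is an isomorphism. Denote the resulting category by $\mathrm{Mod}\text{-}R$ and its full subcategory of cartesian modules by $\mathrm{Mod}_{\mathrm{cart}}(R)$. Let $\mathrm{mod}\text{-}R_c$ be the category of finitely presented right $R_c$-modules, and let $R_{fp}$ be the pseudofunctor from $\mathcal C$ to preadditive categories with $R_{fp}(c)=\mathrm{mod}\text{-}R_c$ and $R_{fp}(\alpha)=A:=\alpha_!|_{\mathrm{mod}\text{-}R_c}$,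 with coherence isomorphisms $F\cong F\otimes_{R_c}R_c$, $x\mapsto x\otimes 1$, and $(F\otimes_{R_c}R_d)\otimes_{R_d}R_e\cong F\otimes_{R_c}R_e$, $(x\otimes r_1)\otimes r_2\mapsto x\otimes R_\beta(r_1)r_2$. A right $R_{fp}$-module $\mathcal M$ consists of an additive functor $\mathcal M_c:(\mathrm{mod}\text{-}R_c)^{op}\to\mathrm{Ab}$ for each object $c$ and a natural transformation $\mathcal M_\alpha:\mathcal M_c\to A^*\mathcal M_d:=\mathcal M_d\circ A$ for each $\alpha:c\to d$, compatible with composition and identities in $\mathcal C$ via the coherence isomorphisms; morphisms are families of natural transformations compatible with the $\mathcal M_\alpha$. It is cartesian if for every $\alpha:c\to d$ the morphism $A_!\mathcal M_c:=\mathcal M_c\otimes_{\mathrm{mod}\text{-}R_c}\mathrm{Hom}_{R_d}(-,A(-))\to\mathcal M_d$ adjoint to $\mathcal M_\alpha$ is an isomorphism. It is locally flat if each $\mathcal M_c$ is flat, i.e. $\mathcal M_c\otimes_{\mathrm{mod}\text{-}R_c}-$ is an exact functor from the category of additive functors $\mathrm{mod}\text{-}R_c\to\mathrm{Ab}$ to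 $\mathrm{Ab}$. Denote by $\mathrm{Mod}\text{-}R_{fp}$ and $\mathrm{Mod}_{\mathrm{cart}}(R_{fp})$ the categories of right $R_{fp}$-modules and of cartesian ones, and by $\mathrm{L.Flat}(\mathrm{Mod}\text{-}R_{fp})$ and $\mathrm{L.Flat}(\mathrm{Mod}_{\mathrm{cart}}(R_{fp}))$ their full subcategories of locally flat modules. Let $Y:\mathrm{Mod}\text{-}R\to\mathrm{Mod}\text{-}R_{fp}$ be the levelwise Yoneda functor: $Y(M)_c=\mathrm{Hom}_{R_c}(-,M_c)|_{\mathrm{mod}\text{-}R_c}$, $Y(M)_\alpha$ sends $f:F\to M_c$ to the morphism $\alpha_!F\to M_d$ adjoint to $M_\alpha\circ f:F\to\alpha^*M_d$, and $Y(\phi)_c=\mathrm{Hom}_{R_c}(-,\phi_c)$. **Theorem (Representation Theorem).** The functor $Y$ takes values in locally flat modules and sends cartesian modules to cartesian modules, and it induces equivalences of categories $$\mathrm{Mod}\text{-}R\;\simeq\;\mathrm{L.Flat}(\mathrm{Mod}\text{-}R_{fp})\qquad\text{and}\qquad \mathrm{Mod}_{\mathrm{cart}}(R)\;\simeq\;\mathrm{L.Flat}(\mathrm{Mod}_{\mathrm{cart}}(R_{fp})).$$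 -/

import Mathlib

open CategoryTheory Opposite
open scoped TensorProduct DirectSum

universe w v u v₁ u₁

noncomputable section

namespace CartRep

/-! ## Modules over a preadditive category

A right module over a preadditive category `A` is an additive functor `Aᵒᵖ ⥤ Ab`, a left module is
an additive functor `A ⥤ Ab`. -/

section PreadditiveModules

variable {A : Type w} [Category.{v} A]

/-- The direct sum of the groups `M(a) ⊗_ℤ N(a)`, over all objects `a` of `A`. -/
abbrev PreTensor (M : Aᵒᵖ ⥤ AddCommGrpCat.{v}) (N : A ⥤ AddCommGrpCat.{v}) : Type (max w v) :=
  ⨁ a : A, (M.obj (op a) ⊗[ℤ] N.obj a)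

open scoped Classical in
/-- The element `x ⊗ y` in the summand indexed by `a`. -/
def preTmul (M : Aᵒᵖ ⥤ AddCommGrpCat.{v}) (N : A ⥤ AddCommGrpCat.{v}) (a : A)
    (x : M.obj (op a)) (y : N.obj a) : PreTensor M N :=
  DirectSum.of (fun a : A => (M.obj (op a) ⊗[ℤ] N.obj a)) a (x ⊗ₜ[ℤ] y)

/-- The subgroup generated by the elements `M(r)(x) ⊗ y - x ⊗ N(r)(y)`,
for `r : a ⟶ b`, `x ∈ M(b)`, `y ∈ N(a)`. -/
def tensorRel (M : Aᵒᵖ ⥤ AddCommGrpCat.{v}) (N : A ⥤ AddCommGrpCat.{v}) :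
    AddSubgroup (PreTensor M N) :=
  AddSubgroup.closure
    {t | ∃ (a b : A) (r : a ⟶ b) (x : M.obj (op b)) (y : N.obj a),
      t = preTmul M N a (M.map r.op x) y - preTmul M N b x (N.map r y)}

/-- The tensor product `M ⊗_A N` of a right module and a left module over `A`. -/
def Tensor (M : Aᵒᵖ ⥤ AddCommGrpCat.{v}) (N : A ⥤ AddCommGrpCat.{v}) : Type (max w v) :=
  PreTensor M N ⧸ tensorRel M N

instance (M : Aᵒᵖ ⥤ AddCommGrpCat.{v}) (N : A ⥤ AddCommGrpCat.{v}) :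
    AddCommGroup (Tensor M N) :=
  inferInstanceAs (AddCommGroup (PreTensor M N ⧸ tensorRel M N))

namespace Tensor

variable {M : Aᵒᵖ ⥤ AddCommGrpCat.{v}} {N N' N'' : A ⥤ AddCommGrpCat.{v}}

/-- The class of `x ⊗ y` in `M ⊗_A N`. -/
def tmul (a : A) (x : M.obj (op a)) (y : N.obj a) : Tensor M N :=
  QuotientAddGroup.mk (preTmul M N a x y)

open scoped Classical in
/-- Two homomorphisms out of `M ⊗_A N` agreeing on the elements `x ⊗ y` are equal. -/
theorem hom_ext {G : Type*} [AddCommGroup G] {f g : Tensor M N →+ G}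
    (h : ∀ (a : A) (x : M.obj (op a)) (y : N.obj a), f (tmul a x y) = g (tmul a x y)) :
    f = g := by
  refine QuotientAddGroup.addMonoidHom_ext _ (DirectSum.addHom_ext' fun a => ?_)
  ext t
  induction t using TensorProduct.induction_on with
  | zero => simp
  | tmul x y => exact h a x y
  | add s t hs ht => simp only [map_add, hs, ht]

open scoped Classical in
/-- The universal property of `M ⊗_A N`: a balanced family of biadditive maps
`M(a) × N(a) → G` induces a homomorphism `M ⊗_A N → G`. -/
def lift {G : Type*} [AddCommGroup G] (β : ∀ a : A, M.obj (op a) →+ N.obj a →+ G)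
    (hβ : ∀ (a b : A) (r : a ⟶ b) (x : M.obj (op b)) (y : N.obj a),
      β a (M.map r.op x) y = β b x (N.map r y)) : Tensor M N →+ G :=
  QuotientAddGroup.lift (tensorRel M N)
    (DirectSum.toAddMonoid fun a => TensorProduct.liftAddHom (β a) fun n x y => by simp)
    (by
      rw [tensorRel, AddSubgroup.closure_le]
      rintro t ⟨a, b, r, x, y, rfl⟩
      simp [preTmul, hβ])

theorem lift_tmul {G : Type*} [AddCommGroup G] (β : ∀ a : A, M.obj (op a) →+ N.obj a →+ G)
    (hβ : ∀ (a b : A) (r : a ⟶ b) (x : M.obj (op b)) (y : N.obj a),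
      β a (M.map r.op x) y = β b x (N.map r y)) (a : A) (x : M.obj (op a)) (y : N.obj a) :
    lift β hβ (tmul a x y) = β a x y := by
  classical
  have h := DirectSum.toAddMonoid_of (fun a => TensorProduct.liftAddHom (β a)
    fun n x y => by simp) a (x ⊗ₜ[ℤ] y)
  exact h.trans (TensorProduct.liftAddHom_tmul _ _ _ _)

theorem tmul_rel {a b : A} (r : a ⟶ b) (x : M.obj (op b)) (y : N.obj a) :
    (tmul a (M.map r.op x) y : Tensor M N) = tmul b x (N.map r y) :=
  QuotientAddGroup.eq_iff_sub_mem.2 (AddSubgroup.subset_closure ⟨a, b, r, x, y, rfl⟩)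

theorem tmul_add (a : A) (x : M.obj (op a)) (y y' : N.obj a) :
    (tmul a x (y + y') : Tensor M N) = tmul a x y + tmul a x y' := by
  simp only [tmul, preTmul, TensorProduct.tmul_add, map_add]; rfl

theorem add_tmul (a : A) (x x' : M.obj (op a)) (y : N.obj a) :
    (tmul a (x + x') y : Tensor M N) = tmul a x y + tmul a x' y := by
  simp only [tmul, preTmul, TensorProduct.add_tmul, map_add]; rfl

/-- Functoriality of `M ⊗_A N` in the left module `N`: the homomorphism `M ⊗_A g`,
`x ⊗ y ↦ x ⊗ g(y)`. -/
def map (M : Aᵒᵖ ⥤ AddCommGrpCat.{v}) (g : N ⟶ N') : Tensor M N →+ Tensor M N' :=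
  lift (fun a => AddMonoidHom.mk' (fun x => AddMonoidHom.mk' (fun y => tmul a x (g.app a y))
      fun y y' => by rw [map_add, tmul_add])
      fun x x' => by ext y; exact add_tmul a x x' _)
    fun a b r x y => by
      simp only [AddMonoidHom.mk'_apply]
      rw [tmul_rel, NatTrans.naturality_apply]

theorem map_tmul (g : N ⟶ N') (a : A) (x : M.obj (op a)) (y : N.obj a) :
    map M g (tmul a x y) = tmul a x (g.app a y) :=
  lift_tmul _ _ a x y

theorem map_id : map M (𝟙 N) = AddMonoidHom.id _ :=
  hom_ext fun a x y => by simp [map_tmul]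

theorem map_comp (g : N ⟶ N') (g' : N' ⟶ N'') :
    map M (g ≫ g') = (map M g').comp (map M g) :=
  hom_ext fun a x y => by simp [map_tmul]

end Tensor

/-- Short exactness of `0 → N₁ → N₂ → N₃ → 0` in a category of additive functors to abelian groups;
it is tested objectwise. -/
structure IsShortExact {N₁ N₂ N₃ : A ⥤ AddCommGrpCat.{v}} (f : N₁ ⟶ N₂) (g : N₂ ⟶ N₃) : Prop where
  injective : ∀ a : A, Function.Injective (f.app a)
  exact : ∀ a : A, Function.Exact (f.app a) (g.app a)
  surjective : ∀ a : A, Function.Surjective (g.app a)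

/-- A right module `M` over `A` is flat if the functor `M ⊗_A -` from left modules to abelian
groups is exact, that is, sends short exact sequences to short exact sequences. -/
def IsFlat [Preadditive A] (M : Aᵒᵖ ⥤ AddCommGrpCat.{v}) : Prop :=
  ∀ (N₁ N₂ N₃ : A ⥤ AddCommGrpCat.{v}) [N₁.Additive] [N₂.Additive] [N₃.Additive]
    (f : N₁ ⟶ N₂) (g : N₂ ⟶ N₃), IsShortExact f g →
      Function.Injective (Tensor.map M f) ∧
      Function.Exact (Tensor.map M f) (Tensor.map M g) ∧
      Function.Surjective (Tensor.map M g)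

variable {B : Type w} [Category.{v} B] [Preadditive B]

/-- The left `A`-module `Hom_B(s, φ(-))`. -/
abbrev homModule (φ : A ⥤ B) (s : B) : A ⥤ AddCommGrpCat.{v} :=
  φ ⋙ preadditiveCoyoneda.obj (op s)

/-- Extension of scalars `φ_! M = M ⊗_A Hom_B(-, φ(-))` of a right `A`-module `M` along
`φ : A ⥤ B`, a right `B`-module. Its values are formed from a sum over all objects of `A`, so that
they live in a universe that also accommodates those. -/
def extendModule (φ : A ⥤ B) (M : Aᵒᵖ ⥤ AddCommGrpCat.{v}) :
    Bᵒᵖ ⥤ AddCommGrpCat.{max w v} where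
  obj s := AddCommGrpCat.of (Tensor M (homModule φ s.unop))
  map f := AddCommGrpCat.ofHom
    (Tensor.map M (Functor.whiskerLeft φ (preadditiveCoyoneda.map f)))
  map_id s := by
    ext1
    refine Tensor.hom_ext fun a x y => ?_
    simp [Tensor.map_tmul]
  map_comp f g := by
    ext1
    refine Tensor.hom_ext fun a x y => ?_
    simp [Tensor.map_tmul]

/-- The component at `s` of the morphism `φ_! M ⟶ N` adjoint to `F : M ⟶ φ^* N`, where
`φ^* N = N ∘ φ`: it sends `m ⊗ f`, for `m ∈ M(a)` and `f : s ⟶ φ(a)`, to `N(f)(F(m))`. -/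
def adjointApp (φ : A ⥤ B) {M : Aᵒᵖ ⥤ AddCommGrpCat.{v}} {N : Bᵒᵖ ⥤ AddCommGrpCat.{v}}
    [N.Additive] (F : M ⟶ φ.op ⋙ N) (s : B) :
    Tensor M (homModule φ s) →+ N.obj (op s) :=
  Tensor.lift
    (fun a => (AddMonoidHom.mk'
      (fun (f : s ⟶ φ.obj a) => (N.map f.op).hom.comp (F.app (op a)).hom)
      fun f f' => by rw [op_add, Functor.map_add]; rfl).flip)
    fun a b r m f => by
      change N.map (show s ⟶ φ.obj a from f).op (F.app (op a) (M.map r.op m)) =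
        N.map ((show s ⟶ φ.obj a from f) ≫ φ.map r).op (F.app (op b) m)
      rw [NatTrans.naturality_apply, op_comp, Functor.map_comp]
      rfl

theorem adjointApp_tmul (φ : A ⥤ B) {M : Aᵒᵖ ⥤ AddCommGrpCat.{v}} {N : Bᵒᵖ ⥤ AddCommGrpCat.{v}}
    [N.Additive] (F : M ⟶ φ.op ⋙ N) (s : B) (a : A) (m : M.obj (op a)) (f : s ⟶ φ.obj a) :
    adjointApp φ F s (Tensor.tmul a m f) = N.map f.op (F.app (op a) m) :=
  Tensor.lift_tmul _ _ _ _ _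

/-- The morphism `φ_! M ⟶ N` adjoint to `F : M ⟶ φ^* N`. -/
def adjointHom (φ : A ⥤ B) {M : Aᵒᵖ ⥤ AddCommGrpCat.{v}} {N : Bᵒᵖ ⥤ AddCommGrpCat.{v}}
    [N.Additive] (F : M ⟶ φ.op ⋙ N) :
    extendModule φ M ⟶ N ⋙ AddCommGrpCat.uliftFunctor.{w, v} where
  app s := AddCommGrpCat.ofHom
    (AddEquiv.ulift.symm.toAddMonoidHom.comp (adjointApp φ F s.unop))
  naturality s t f := by
    ext1
    refine Tensor.hom_ext fun a x y => ULift.ext _ _ ?_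
    change adjointApp φ F t.unop (Tensor.map M _ (Tensor.tmul a x y)) =
      N.map f (adjointApp φ F s.unop (Tensor.tmul a x y))
    rw [Tensor.map_tmul]
    refine (adjointApp_tmul φ F _ a x (f.unop ≫ (show s.unop ⟶ φ.obj a from y))).trans ?_
    refine Eq.trans ?_ (congrArg _ (adjointApp_tmul φ F _ a x y).symm)
    rw [op_comp, Functor.map_comp]
    rfl

end PreadditiveModules

/-! ## Representations of a category and their modules -/

set_option linter.checkUnivs false in
/-- A representation of `C`: a pseudofunctor `R` from `C` to preadditive categories and additive
functors. The coherence isomorphism `μ h : R_β R_α ≅ R_γ` is indexed by the compositions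
`h : α ≫ β = γ`. -/
structure AddRep (C : Type u₁) [Category.{v₁} C] where
  obj : C → Type w
  [category : ∀ c, Category.{v} (obj c)]
  [preadditive : ∀ c, Preadditive (obj c)]
  map {c d : C} (α : c ⟶ d) : obj c ⥤ obj d
  [additive : ∀ {c d : C} (α : c ⟶ d), (map α).Additive]
  δ (c : C) : 𝟭 (obj c) ≅ map (𝟙 c)
  μ {c d e : C} {α : c ⟶ d} {β : d ⟶ e} {γ : c ⟶ e} (h : α ≫ β = γ) : map α ⋙ map β ≅ map γ
  μ_assoc {c d e f : C} {α : c ⟶ d} {β : d ⟶ e} {γ : e ⟶ f} {αβ : c ⟶ e} {βγ : d ⟶ f}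
    {αβγ : c ⟶ f} (h₁ : α ≫ β = αβ) (h₂ : β ≫ γ = βγ) (h₃ : αβ ≫ γ = αβγ) (h₄ : α ≫ βγ = αβγ)
    (a : obj c) :
    (map γ).map ((μ h₁).hom.app a) ≫ (μ h₃).hom.app a =
      (μ h₂).hom.app ((map α).obj a) ≫ (μ h₄).hom.app a
  δ_μ {c d : C} (α : c ⟶ d) (a : obj c) :
    (map α).map ((δ c).hom.app a) ≫ (μ (Category.id_comp α)).hom.app a = 𝟙 ((map α).obj a)
  μ_δ {c d : C} (α : c ⟶ d) (a : obj c) :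
    (δ d).hom.app ((map α).obj a) ≫ (μ (Category.comp_id α)).hom.app a = 𝟙 ((map α).obj a)

attribute [instance] AddRep.category AddRep.preadditive AddRep.additive

section Modules

variable {C : Type u₁} [Category.{v₁} C]

/-- A right module over the representation `R`. -/
structure AddRep.RightMod (R : AddRep.{w, v} C) where
  obj (c : C) : (R.obj c)ᵒᵖ ⥤ AddCommGrpCat.{v}
  [additive : ∀ c, (obj c).Additive]
  /-- The structural morphism `M_α : M_c ⟶ α^* M_d`. -/
  map {c d : C} (α : c ⟶ d) : obj c ⟶ (R.map α).op ⋙ obj d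
  map_comp {c d e : C} {α : c ⟶ d} {β : d ⟶ e} {γ : c ⟶ e} (h : α ≫ β = γ) (a : R.obj c) :
    (map γ).app (op a) ≫ (obj e).map ((R.μ h).hom.app a).op =
      (map α).app (op a) ≫ (map β).app (op ((R.map α).obj a))
  map_id (c : C) (a : R.obj c) :
    (map (𝟙 c)).app (op a) ≫ (obj c).map ((R.δ c).hom.app a).op = 𝟙 ((obj c).obj (op a))

attribute [instance] AddRep.RightMod.additive

namespace AddRep.RightMod

variable {R : AddRep.{w, v} C}

/-- A morphism of right modules over a representation. -/
@[ext]
structure Hom (M N : R.RightMod) where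
  app (c : C) : M.obj c ⟶ N.obj c
  comm {c d : C} (α : c ⟶ d) :
    M.map α ≫ Functor.whiskerLeft (R.map α).op (app d) = app c ≫ N.map α

/-- The category `Mod-R`. -/
instance : Category R.RightMod where
  Hom M N := Hom M N
  id M :=
    { app := fun c => 𝟙 (M.obj c)
      comm := fun α => by simp }
  comp f g :=
    { app := fun c => f.app c ≫ g.app c
      comm := fun α => by
        rw [Functor.whiskerLeft_comp, ← Category.assoc, f.comm, Category.assoc, g.comm,
          Category.assoc] }
  id_comp f := Hom.ext (funext fun c => Category.id_comp (f.app c))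
  comp_id f := Hom.ext (funext fun c => Category.comp_id (f.app c))
  assoc f g h := Hom.ext (funext fun c => Category.assoc (f.app c) (g.app c) (h.app c))

/-- A right module `M` is cartesian if for every `α : c ⟶ d` the morphism `α_! M_c ⟶ M_d` adjoint
to `M_α : M_c ⟶ α^* M_d` is an isomorphism. -/
def IsCartesian (R : AddRep.{w, v} C) : ObjectProperty R.RightMod :=
  fun M => ∀ ⦃c d : C⦄ (α : c ⟶ d), IsIso (adjointHom (R.map α) (M.map α))

/-- A right module `M` is locally flat if `M_c` is a flat right module over `R_c`, for all `c`. -/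
def IsLocallyFlat (R : AddRep.{w, v} C) : ObjectProperty R.RightMod :=
  fun M => ∀ c : C, IsFlat (M.obj c)

end AddRep.RightMod

end Modules

/-! ## Change of rings

Right modules over a ring `R` are modules over `Rᵐᵒᵖ`, so that change of rings is set up here for
left modules over not necessarily commutative rings. -/

section ChangeOfRings

variable {A B D : Type u} [Ring A] [Ring B] [Ring D]

/-- The relations `b φ(a) ⊗ m = b ⊗ a m`. -/
def baseChangeRel (φ : A →+* B) (M : Type u) [AddCommGroup M] [Module A M] :
    Submodule B (B ⊗[ℤ] M) :=
  Submodule.span B {t | ∃ (b : B) (a : A) (m : M), t = (b * φ a) ⊗ₜ[ℤ] m - b ⊗ₜ[ℤ] (a • m)}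

/-- The `B`-module `B ⊗_A M`. If `A = Rᵐᵒᵖ` and `B = Sᵐᵒᵖ`, this is the right `S`-module
`M ⊗_R S`, with the order of the two factors reversed. -/
abbrev BaseChange (φ : A →+* B) (M : Type u) [AddCommGroup M] [Module A M] : Type u :=
  (B ⊗[ℤ] M) ⧸ baseChangeRel φ M

namespace BaseChange

variable (φ : A →+* B) {M : Type u} [AddCommGroup M] [Module A M]

/-- The element `b ⊗ m` of `B ⊗_A M`. -/
def tmul (b : B) (m : M) : BaseChange φ M := (baseChangeRel φ M).mkQ (b ⊗ₜ[ℤ] m)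

theorem tmul_add (b : B) (m m' : M) : tmul φ b (m + m') = tmul φ b m + tmul φ b m' := by
  simp only [tmul, TensorProduct.tmul_add, map_add]

theorem add_tmul (b b' : B) (m : M) : tmul φ (b + b') m = tmul φ b m + tmul φ b' m := by
  simp only [tmul, TensorProduct.add_tmul, map_add]

theorem smul_tmul (b b' : B) (m : M) : b • tmul φ b' m = tmul φ (b * b') m := by
  simp only [tmul, ← map_smul, TensorProduct.smul_tmul', smul_eq_mul]

theorem mul_tmul (b : B) (a : A) (m : M) : tmul φ (b * φ a) m = tmul φ b (a • m) :=
  (Submodule.Quotient.eq _).2 (Submodule.subset_span ⟨b, a, m, rfl⟩)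

theorem alg_tmul (a : A) (m : M) : tmul φ (φ a) m = tmul φ 1 (a • m) := by
  rw [← mul_tmul, one_mul]

variable {φ}

theorem hom_ext {P : Type*} [AddCommGroup P] [Module B P] {f g : BaseChange φ M →ₗ[B] P}
    (h : ∀ m : M, f (tmul φ 1 m) = g (tmul φ 1 m)) : f = g := by
  refine Submodule.linearMap_qext _ (LinearMap.ext fun t => ?_)
  induction t using TensorProduct.induction_on with
  | zero => simp
  | tmul b m =>
    change f (tmul φ b m) = g (tmul φ b m)
    rw [← mul_one b, ← smul_tmul, map_smul, map_smul, h]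
  | add s t hs ht => simp only [map_add, hs, ht]

/-- The additive map `B ⊗_ℤ M → P`, `b ⊗ m ↦ b g(m)`. -/
def preLift {P : Type*} [AddCommGroup P] [Module B P] (g : M →ₛₗ[φ] P) : B ⊗[ℤ] M →+ P :=
  TensorProduct.liftAddHom
    (AddMonoidHom.mk' (fun b : B => AddMonoidHom.mk' (fun m : M => b • g m)
      fun m m' => by rw [map_add, smul_add])
      fun b b' => by ext m; exact add_smul b b' (g m))
    fun n b m => by
      change (n • b) • g m = b • g (n • m)
      rw [map_zsmul, smul_assoc, smul_comm]

theorem preLift_tmul {P : Type*} [AddCommGroup P] [Module B P] (g : M →ₛₗ[φ] P) (b : B) (m : M) :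
    preLift g (b ⊗ₜ m) = b • g m :=
  TensorProduct.liftAddHom_tmul _ _ _ _

/-- The universal property of `B ⊗_A M`: a `φ`-semilinear map `M → P` extends to a `B`-linear map
`B ⊗_A M → P`. -/
def lift {P : Type*} [AddCommGroup P] [Module B P] (g : M →ₛₗ[φ] P) : BaseChange φ M →ₗ[B] P :=
  (baseChangeRel φ M).liftQ
    { toFun := preLift g
      map_add' := fun s t => map_add _ s t
      map_smul' := fun b t => by
        induction t using TensorProduct.induction_on with
        | zero => simp
        | tmul b' m =>
          rw [TensorProduct.smul_tmul', preLift_tmul, preLift_tmul, smul_eq_mul, mul_smul]; rfl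
        | add s t hs ht => simp only [smul_add, map_add, hs, ht] }
    (by
      rw [baseChangeRel, Submodule.span_le]
      rintro t ⟨b, a, m, rfl⟩
      have h : preLift g ((b * φ a) ⊗ₜ[ℤ] m - b ⊗ₜ[ℤ] (a • m)) = 0 := by
        rw [map_sub, preLift_tmul, preLift_tmul, map_smulₛₗ, mul_smul, sub_self]
      exact h)

theorem lift_tmul {P : Type*} [AddCommGroup P] [Module B P] (g : M →ₛₗ[φ] P) (b : B) (m : M) :
    lift g (tmul φ b m) = b • g m :=
  preLift_tmul g b m

/-- Base change along a ring homomorphism preserves finite presentation. -/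
theorem finitePresentation (φ : A →+* B) (M : Type u) [AddCommGroup M] [Module A M]
    [h : Module.FinitePresentation A M] : Module.FinitePresentation B (BaseChange φ M) := by
  obtain ⟨s, hs, t, ht⟩ := h
  let p : (s →₀ A) →ₗ[A] M := Finsupp.linearCombination A ((↑) : s → M)
  have hp : Function.Surjective p := by
    rw [← LinearMap.range_eq_top, Finsupp.range_linearCombination, Subtype.range_coe_subtype]
    exact hs
  let j : (s →₀ A) →ₛₗ[φ] (s →₀ B) :=
    { toFun := fun x => x.mapRange φ (map_zero φ)
      map_add' := fun x y => Finsupp.mapRange_add (map_add φ) x y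
      map_smul' := fun a x => by ext i; simp }
  have hj : ∀ i a, j (Finsupp.single i a) = Finsupp.single i (φ a) := fun i a =>
    Finsupp.mapRange_single (hf := map_zero φ)
  let q : (s →₀ B) →ₗ[B] BaseChange φ M :=
    Finsupp.linearCombination B (fun i : s => tmul φ 1 (i : M))
  have hq : ∀ i b, q (Finsupp.single i b) = b • tmul φ 1 (i : M) := fun i b =>
    Finsupp.linearCombination_single B b i
  have hqj : ∀ x, q (j x) = tmul φ 1 (p x) := fun x => by
    induction x using Finsupp.induction_linear with
    | zero => simp [tmul]
    | add x y hx hy => rw [map_add, map_add, map_add, tmul_add, hx, hy]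
    | single i a =>
      rw [hj, hq, smul_tmul, mul_one, alg_tmul]
      exact congrArg _ (Finsupp.linearCombination_single A a i).symm
  have hsurj : Function.Surjective q := by
    rw [← LinearMap.range_eq_top, eq_top_iff]
    rintro x -
    obtain ⟨x, rfl⟩ := Submodule.mkQ_surjective _ x
    induction x using TensorProduct.induction_on with
    | zero => simp
    | tmul b m =>
      obtain ⟨y, rfl⟩ := hp m
      refine ⟨b • j y, ?_⟩
      rw [map_smul, hqj, smul_tmul, mul_one]
      rfl
    | add x y hx hy => rw [map_add]; exact add_mem hx hy
  let K : Submodule B (s →₀ B) := Submodule.span B (j '' t)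
  have hK : ∀ x y, p x = p y → K.mkQ (j x) = K.mkQ (j y) := fun x y hxy => by
    have hmem : x - y ∈ Submodule.span A (t : Set (s →₀ A)) := by
      rw [ht]
      exact LinearMap.mem_ker.2 (by rw [map_sub]; exact sub_eq_zero.2 hxy)
    have hle : Submodule.span A (t : Set (s →₀ A)) ≤ K.comap j :=
      Submodule.span_le.2 fun z hz => Submodule.subset_span ⟨z, hz, rfl⟩
    refine (Submodule.Quotient.eq K).2 ?_
    rw [← map_sub]
    exact hle hmem
  choose σ hσ using hp
  let g : M →ₛₗ[φ] ((s →₀ B) ⧸ K) :=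
    { toFun := fun m => K.mkQ (j (σ m))
      map_add' := fun m m' => by
        rw [← map_add, ← map_add]
        exact hK _ _ (by rw [map_add, hσ, hσ, hσ])
      map_smul' := fun a m => by
        rw [← map_smul, ← map_smulₛₗ]
        exact hK _ _ (by rw [map_smul, hσ, hσ]) }
  have hg : (lift g).comp q = K.mkQ := by
    refine Finsupp.lhom_ext fun i b => ?_
    rw [LinearMap.comp_apply, hq, smul_tmul, mul_one, lift_tmul]
    have h1 : g (i : M) = K.mkQ (j (Finsupp.single i 1)) :=
      hK _ _ ((hσ _).trans (by simp [p]))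
    rw [h1, hj, ← map_smul, Finsupp.smul_single, map_one, smul_eq_mul, mul_one]
  have hker : LinearMap.ker q = K := by
    refine le_antisymm (fun x hx => ?_) (Submodule.span_le.2 ?_)
    · have h0 := LinearMap.congr_fun hg x
      rw [LinearMap.comp_apply, LinearMap.mem_ker.1 hx, map_zero] at h0
      exact (Submodule.Quotient.mk_eq_zero K).1 h0.symm
    · rintro _ ⟨x, hx, rfl⟩
      have h0 : p x = 0 := LinearMap.mem_ker.1 (ht ▸ Submodule.subset_span hx)
      refine LinearMap.mem_ker.2 ?_
      rw [hqj, h0]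
      simp [tmul]
  refine Module.finitePresentation_of_surjective q hsurj ?_
  rw [hker]
  exact ⟨(t.finite_toSet.image j).toFinset, by simp [K]⟩

/-- The homomorphism `B ⊗_A g`, `b ⊗ m ↦ b ⊗ g(m)`. -/
def map (φ : A →+* B) {M N : Type u} [AddCommGroup M] [Module A M] [AddCommGroup N] [Module A N]
    (g : M →ₗ[A] N) : BaseChange φ M →ₗ[B] BaseChange φ N :=
  lift
    { toFun := fun m => tmul φ 1 (g m)
      map_add' := fun m m' => by rw [map_add, tmul_add]
      map_smul' := fun a m => by rw [map_smul, smul_tmul, mul_one, alg_tmul] }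

theorem map_tmul (φ : A →+* B) {M N : Type u} [AddCommGroup M] [Module A M] [AddCommGroup N]
    [Module A N] (g : M →ₗ[A] N) (b : B) (m : M) :
    map φ g (tmul φ b m) = tmul φ b (g m) := by
  refine (lift_tmul _ _ _).trans ?_
  change b • tmul φ 1 (g m) = _
  rw [smul_tmul, mul_one]

/-- The isomorphism `M ≃ A ⊗_A M`, `m ↦ 1 ⊗ m`. -/
def idEquiv {φ : A →+* A} (h : φ = RingHom.id A) (M : Type u) [AddCommGroup M] [Module A M] :
    M ≃ₗ[A] BaseChange φ M :=
  LinearEquiv.ofLinearMap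
    { toFun := fun m => tmul φ 1 m
      map_add' := fun m m' => tmul_add φ 1 m m'
      map_smul' := fun a m => by
        rw [← alg_tmul, RingHom.id_apply, smul_tmul, mul_one, h, RingHom.id_apply] }
    (lift
      { toFun := fun m => m
        map_add' := fun m m' => rfl
        map_smul' := fun a m => by rw [h, RingHom.id_apply] })
    (hom_ext fun m => congrArg (tmul φ 1) ((lift_tmul _ _ _).trans (one_smul A m)))
    (LinearMap.ext fun m => (lift_tmul _ _ _).trans (one_smul A m))

/-- A variant of `lift`: for `χ = ψ ∘ φ`, a `χ`-semilinear map `M → P` extends to a `ψ`-semilinear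
map `B ⊗_A M → P`. -/
def liftSemi {φ : A →+* B} {ψ : B →+* D} {χ : A →+* D} (h : ψ.comp φ = χ) {P : Type*}
    [AddCommGroup P] [Module D P] (g : M →ₛₗ[χ] P) : BaseChange φ M →ₛₗ[ψ] P :=
  letI : Module B P := Module.compHom P ψ
  let l : BaseChange φ M →ₗ[B] P := lift
    { toFun := g
      map_add' := map_add g
      map_smul' := fun a m => (map_smulₛₗ g a m).trans (by subst h; rfl) }
  { toFun := l
    map_add' := map_add l
    map_smul' := map_smul l }

theorem liftSemi_tmul {φ : A →+* B} {ψ : B →+* D} {χ : A →+* D} (h : ψ.comp φ = χ) {P : Type*}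
    [AddCommGroup P] [Module D P] (g : M →ₛₗ[χ] P) (b : B) (m : M) :
    liftSemi h g (tmul φ b m) = ψ b • g m :=
  letI : Module B P := Module.compHom P ψ
  lift_tmul (φ := φ)
    { toFun := g
      map_add' := map_add g
      map_smul' := fun a m => (map_smulₛₗ g a m).trans (by subst h; rfl) } b m

/-- The homomorphism `D ⊗_B (B ⊗_A M) → D ⊗_A M`, `d ⊗ (b ⊗ m) ↦ d ψ(b) ⊗ m`. -/
def compHom {φ : A →+* B} {ψ : B →+* D} {χ : A →+* D} (h : ψ.comp φ = χ)
    (M : Type u) [AddCommGroup M] [Module A M] :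
    BaseChange ψ (BaseChange φ M) →ₗ[D] BaseChange χ M :=
  lift (liftSemi h
    { toFun := fun m => tmul χ 1 m
      map_add' := fun m m' => tmul_add χ 1 m m'
      map_smul' := fun a m => by rw [smul_tmul, mul_one, alg_tmul] })

theorem compHom_tmul {φ : A →+* B} {ψ : B →+* D} {χ : A →+* D} (h : ψ.comp φ = χ)
    (d : D) (b : B) (m : M) :
    compHom h M (tmul ψ d (tmul φ b m)) = tmul χ (d * ψ b) m := by
  rw [compHom, lift_tmul, liftSemi_tmul]
  change d • ψ b • tmul χ 1 m = _
  rw [smul_tmul, smul_tmul, mul_one]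

theorem hom_ext₂ {φ : A →+* B} {ψ : B →+* D} {P : Type*} [AddCommGroup P] [Module D P]
    {f g : BaseChange ψ (BaseChange φ M) →ₗ[D] P}
    (h : ∀ m : M, f (tmul ψ 1 (tmul φ 1 m)) = g (tmul ψ 1 (tmul φ 1 m))) : f = g := by
  refine hom_ext fun x => ?_
  obtain ⟨x, rfl⟩ := Submodule.mkQ_surjective _ x
  induction x using TensorProduct.induction_on with
  | zero => simp [tmul]
  | tmul b m =>
    change f (tmul ψ 1 (tmul φ b m)) = g (tmul ψ 1 (tmul φ b m))
    rw [← mul_one b, ← smul_tmul, ← alg_tmul, ← mul_one (ψ b), ← smul_tmul, map_smul, map_smul, h]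
  | add x y hx hy => rw [map_add, tmul_add, map_add, map_add, hx, hy]

theorem hom_ext₃ {E : Type u} [Ring E] {φ : A →+* B} {ψ : B →+* D} {θ : D →+* E} {P : Type*}
    [AddCommGroup P] [Module E P]
    {f g : BaseChange θ (BaseChange ψ (BaseChange φ M)) →ₗ[E] P}
    (h : ∀ m : M, f (tmul θ 1 (tmul ψ 1 (tmul φ 1 m))) = g (tmul θ 1 (tmul ψ 1 (tmul φ 1 m)))) :
    f = g := by
  refine hom_ext₂ fun x => ?_
  obtain ⟨x, rfl⟩ := Submodule.mkQ_surjective _ x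
  induction x using TensorProduct.induction_on with
  | zero => simp [tmul]
  | tmul b m =>
    change f (tmul θ 1 (tmul ψ 1 (tmul φ b m))) = g (tmul θ 1 (tmul ψ 1 (tmul φ b m)))
    rw [← mul_one b, ← smul_tmul, ← alg_tmul, ← mul_one (ψ b), ← smul_tmul, ← alg_tmul,
      ← mul_one (θ (ψ b)), ← smul_tmul, map_smul, map_smul, h]
  | add x y hx hy =>
    rw [map_add, tmul_add, tmul_add, map_add, map_add, hx, hy]

/-- The isomorphism `D ⊗_B (B ⊗_A M) ≃ D ⊗_A M`, `d ⊗ (b ⊗ m) ↦ d ψ(b) ⊗ m`. -/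
def compEquiv {φ : A →+* B} {ψ : B →+* D} {χ : A →+* D} (h : ψ.comp φ = χ)
    (M : Type u) [AddCommGroup M] [Module A M] :
    BaseChange ψ (BaseChange φ M) ≃ₗ[D] BaseChange χ M :=
  LinearEquiv.ofLinearMap (compHom h M)
    (lift
      { toFun := fun m => tmul ψ 1 (tmul φ 1 m)
        map_add' := fun m m' => by rw [tmul_add, tmul_add]
        map_smul' := fun a m => by
          rw [← alg_tmul, ← mul_one (φ a), ← smul_tmul, ← alg_tmul, smul_tmul, mul_one, ← h,
            RingHom.comp_apply] })
    (hom_ext fun m => by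
      rw [LinearMap.comp_apply, lift_tmul, one_smul]
      refine (compHom_tmul h 1 1 m).trans ?_
      rw [map_one, mul_one]
      rfl)
    (hom_ext₂ fun m => by
      rw [LinearMap.comp_apply, compHom_tmul, map_one, mul_one, lift_tmul, one_smul]
      rfl)

theorem compEquiv_tmul {φ : A →+* B} {ψ : B →+* D} {χ : A →+* D} (h : ψ.comp φ = χ)
    (d : D) (b : B) (m : M) :
    compEquiv h M (tmul ψ d (tmul φ b m)) = tmul χ (d * ψ b) m :=
  compHom_tmul h d b m

end BaseChange

/-- Extension of scalars `φ_!` along a homomorphism of not necessarily commutative rings. -/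
@[simps obj]
def extendScalars (φ : A →+* B) : ModuleCat.{u} A ⥤ ModuleCat.{u} B where
  obj M := ModuleCat.of B (BaseChange φ M)
  map {M N} g := ModuleCat.ofHom (BaseChange.map φ g.hom)
  map_id M := by
    ext1
    refine BaseChange.hom_ext (φ := φ) (M := M) fun m => ?_
    exact BaseChange.map_tmul φ (𝟙 M : M ⟶ M).hom 1 m
  map_comp g g' := by
    ext1
    refine BaseChange.hom_ext fun m => ?_
    change BaseChange.map φ (g ≫ g').hom (BaseChange.tmul φ 1 m) =
      BaseChange.map φ g'.hom (BaseChange.map φ g.hom (BaseChange.tmul φ 1 m))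
    rw [BaseChange.map_tmul, BaseChange.map_tmul, BaseChange.map_tmul]
    rfl

instance (φ : A →+* B) : (extendScalars φ).Additive where
  map_add {M N f g} := by
    ext1
    refine BaseChange.hom_ext fun m => ?_
    change BaseChange.map φ (f.hom + g.hom) _ = BaseChange.map φ f.hom _ + BaseChange.map φ g.hom _
    rw [BaseChange.map_tmul, BaseChange.map_tmul, BaseChange.map_tmul, LinearMap.add_apply,
      BaseChange.tmul_add]

/-- A linear map `M → φ^* P` into a restriction of scalars, as a `φ`-semilinear map `M → P`. -/
def toSemilinear (φ : A →+* B) {M : ModuleCat.{u} A} {P : ModuleCat.{u} B}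
    (g : M ⟶ (ModuleCat.restrictScalars φ).obj P) : M →ₛₗ[φ] P where
  toFun m := g.hom m
  map_add' m m' := map_add g.hom m m'
  map_smul' a m := map_smul g.hom a m

/-- A `φ`-semilinear map `M → P` as a linear map `M → φ^* P`. -/
def ofSemilinear (φ : A →+* B) {M : ModuleCat.{u} A} {P : ModuleCat.{u} B}
    (g : M →ₛₗ[φ] P) : M ⟶ (ModuleCat.restrictScalars φ).obj P :=
  ModuleCat.ofHom (Y := (ModuleCat.restrictScalars φ).obj P)
    { toFun := g
      map_add' := map_add g
      map_smul' := map_smulₛₗ g }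

/-- The adjunction `φ_! ⊣ φ^*` between extension and restriction of scalars: a linear map
`g : M → φ^* P` corresponds to `b ⊗ m ↦ b g(m)`. -/
def extendRestrictAdj (φ : A →+* B) :
    extendScalars φ ⊣ ModuleCat.restrictScalars.{u} φ :=
  Adjunction.mkOfHomEquiv
    { homEquiv := fun M P =>
        { toFun := fun f => ofSemilinear φ
            { toFun := fun m => f.hom (BaseChange.tmul φ 1 m)
              map_add' := fun m m' => by rw [BaseChange.tmul_add]; exact map_add f.hom _ _
              map_smul' := fun a m => by
                rw [← BaseChange.alg_tmul, ← mul_one (φ a), ← BaseChange.smul_tmul, mul_one]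
                exact map_smul f.hom _ _ }
          invFun := fun g => ModuleCat.ofHom (BaseChange.lift (toSemilinear φ g))
          left_inv := fun f => by
            ext1
            exact BaseChange.hom_ext fun m => (BaseChange.lift_tmul _ _ _).trans (one_smul _ _)
          right_inv := fun g => by
            ext m
            exact (BaseChange.lift_tmul (toSemilinear φ g) 1 m).trans (one_smul B _) }
      homEquiv_naturality_left_symm := fun f g => by
        ext1
        refine BaseChange.hom_ext fun m => ?_
        refine (BaseChange.lift_tmul _ _ _).trans ?_
        exact ((congrArg (BaseChange.lift (toSemilinear φ g))
          (BaseChange.map_tmul φ f.hom 1 m)).trans (BaseChange.lift_tmul _ _ _)).symm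
      homEquiv_naturality_right := fun f g => rfl }

theorem extendRestrictAdj_symm_tmul (φ : A →+* B) {M : ModuleCat.{u} A} {P : ModuleCat.{u} B}
    (g : M ⟶ (ModuleCat.restrictScalars φ).obj P) (b : B) (m : M) :
    (((extendRestrictAdj φ).homEquiv M P).symm g).hom (BaseChange.tmul φ b m) =
      b • toSemilinear φ g m := by
  rw [extendRestrictAdj, Adjunction.mkOfHomEquiv_homEquiv]
  exact BaseChange.lift_tmul _ _ _

theorem extendRestrictAdj_symm_add (φ : A →+* B) {M : ModuleCat.{u} A} {P : ModuleCat.{u} B}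
    (f g : M ⟶ (ModuleCat.restrictScalars φ).obj P) :
    ((extendRestrictAdj φ).homEquiv M P).symm (f + g) =
      ((extendRestrictAdj φ).homEquiv M P).symm f +
        ((extendRestrictAdj φ).homEquiv M P).symm g := by
  rw [Adjunction.homEquiv_counit, Functor.map_add, Preadditive.add_comp,
    ← Adjunction.homEquiv_counit, ← Adjunction.homEquiv_counit]

/-- The property of being a finitely presented module. -/
def isFP (A : Type u) [Ring A] : ObjectProperty (ModuleCat.{u} A) :=
  fun M => Module.FinitePresentation A M

/-- The category of finitely presented `A`-modules; for `A = Rᵐᵒᵖ` this is `mod-R`. -/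
abbrev FPMod (A : Type u) [Ring A] : Type (u + 1) := (isFP A).FullSubcategory

/-- The restriction of `φ_!` to finitely presented modules. -/
def fpExtend (φ : A →+* B) : FPMod A ⥤ FPMod B :=
  (isFP B).lift ((isFP A).ι ⋙ extendScalars φ) fun M =>
    haveI : Module.FinitePresentation A M.obj := M.property
    BaseChange.finitePresentation φ M.obj

instance (φ : A →+* B) : (fpExtend φ).Additive where
  map_add {_ _ f g} := (isFP B).hom_ext ((extendScalars φ).map_add (f := f.hom) (g := g.hom))

/-- The natural isomorphism `F ≅ φ_! F`, `x ↦ 1 ⊗ x`, for `φ` the identity. -/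
def fpExtendId {φ : A →+* A} (h : φ = RingHom.id A) : 𝟭 (FPMod A) ≅ fpExtend φ :=
  NatIso.ofComponents
    (fun M => (isFP A).isoMk (BaseChange.idEquiv h M.obj).toModuleIso)
    fun f => by
      ext1
      ext x
      exact (BaseChange.map_tmul φ f.hom.hom 1 x).symm

/-- The natural isomorphism `ψ_! φ_! F ≅ χ_! F`, `d ⊗ (b ⊗ x) ↦ d ψ(b) ⊗ x`, for `χ = ψ ∘ φ`. -/
def fpExtendComp {φ : A →+* B} {ψ : B →+* D} {χ : A →+* D} (h : ψ.comp φ = χ) :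
    fpExtend φ ⋙ fpExtend ψ ≅ fpExtend χ :=
  NatIso.ofComponents
    (fun M => (isFP D).isoMk (BaseChange.compEquiv h M.obj).toModuleIso)
    fun f => by
      ext1
      ext1
      refine BaseChange.hom_ext₂ fun x => ?_
      change BaseChange.compEquiv h _ (BaseChange.map ψ (BaseChange.map φ f.hom.hom)
          (BaseChange.tmul ψ 1 (BaseChange.tmul φ 1 x))) =
        BaseChange.map χ f.hom.hom (BaseChange.compEquiv h _
          (BaseChange.tmul ψ 1 (BaseChange.tmul φ 1 x)))
      rw [BaseChange.map_tmul, BaseChange.map_tmul, BaseChange.compEquiv_tmul,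
        BaseChange.compEquiv_tmul, BaseChange.map_tmul]

end ChangeOfRings

/-! ## Strict representations in rings -/

section Strict

variable {C : Type u₁} [Category.{v₁} C]

/-- The homomorphism `R_α : R_c → R_d`, viewed between the opposite rings. -/
abbrev opMap (R : C ⥤ RingCat.{u}) {c d : C} (α : c ⟶ d) : (R.obj c)ᵐᵒᵖ →+* (R.obj d)ᵐᵒᵖ :=
  RingHom.op (R.map α).hom

theorem opMap_id (R : C ⥤ RingCat.{u}) (c : C) : opMap R (𝟙 c) = RingHom.id (R.obj c)ᵐᵒᵖ := by
  ext x
  simp [opMap]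

theorem opMap_comp (R : C ⥤ RingCat.{u}) {c d e : C} {α : c ⟶ d} {β : d ⟶ e} {γ : c ⟶ e}
    (h : α ≫ β = γ) : (opMap R β).comp (opMap R α) = opMap R γ := by
  subst h
  ext x
  simp [opMap]

/-- The representation `R_fp` induced by a strict representation `R` in rings: it sends `c` to the
category `mod-R_c` of finitely presented right `R_c`-modules and `α : c ⟶ d` to
`- ⊗_{R_c} R_d`. -/
def fpRep (R : C ⥤ RingCat.{u}) : AddRep.{u + 1, u} C where
  obj c := FPMod (R.obj c)ᵐᵒᵖ
  map α := fpExtend (opMap R α)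
  δ c := fpExtendId (opMap_id R c)
  μ h := fpExtendComp (opMap_comp R h)
  μ_assoc {c d e f α β γ αβ βγ αβγ} h₁ h₂ h₃ h₄ F := by
    ext1
    ext1
    refine BaseChange.hom_ext₃ fun x => ?_
    refine (congrArg (BaseChange.compEquiv (opMap_comp R h₃) F.obj)
      (BaseChange.map_tmul _ _ _ _)).trans ?_
    refine (congrArg (fun z => BaseChange.compEquiv (opMap_comp R h₃) F.obj
      (BaseChange.tmul _ _ z)) (BaseChange.compEquiv_tmul (opMap_comp R h₁) _ _ _)).trans ?_
    refine (BaseChange.compEquiv_tmul (opMap_comp R h₃) _ _ _).trans ?_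
    refine Eq.trans ?_ (congrArg (BaseChange.compEquiv (opMap_comp R h₄) F.obj)
      (BaseChange.compEquiv_tmul (opMap_comp R h₂) _ _ _)).symm
    refine Eq.trans ?_ (BaseChange.compEquiv_tmul (opMap_comp R h₄) _ _ _).symm
    simp only [map_one, mul_one]
  δ_μ {c d} α F := by
    ext1
    ext1
    refine BaseChange.hom_ext fun x => ?_
    refine (congrArg (BaseChange.compEquiv (opMap_comp R (Category.id_comp α)) F.obj)
      (BaseChange.map_tmul _ _ _ _)).trans ?_
    refine (BaseChange.compEquiv_tmul _ _ _ _).trans ?_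
    rw [map_one, mul_one]
    rfl
  μ_δ {c d} α F := by
    ext1
    ext1
    refine BaseChange.hom_ext fun x => ?_
    refine (BaseChange.compEquiv_tmul (opMap_comp R (Category.comp_id α)) _ _ _).trans ?_
    rw [map_one, mul_one]
    rfl

/-- A right module over a strict representation `R` in rings. -/
structure RingMod (R : C ⥤ RingCat.{u}) where
  obj (c : C) : ModuleCat.{u} (R.obj c)ᵐᵒᵖ
  /-- The structural morphism `M_α : M_c ⟶ α^* M_d`. -/
  map {c d : C} (α : c ⟶ d) : obj c ⟶ (ModuleCat.restrictScalars (opMap R α)).obj (obj d)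
  map_comp {c d e : C} (α : c ⟶ d) (β : d ⟶ e) (m : obj c) :
    toSemilinear _ (map (α ≫ β)) m = toSemilinear _ (map β) (toSemilinear _ (map α) m)
  map_id (c : C) (m : obj c) : toSemilinear _ (map (𝟙 c)) m = m

namespace RingMod

variable {R : C ⥤ RingCat.{u}}

/-- A morphism of right modules over a strict representation. -/
@[ext]
structure Hom (M N : RingMod R) where
  app (c : C) : M.obj c ⟶ N.obj c
  comm {c d : C} (α : c ⟶ d) :
    M.map α ≫ (ModuleCat.restrictScalars (opMap R α)).map (app d) = app c ≫ N.map α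

/-- The category `Mod-R`. -/
instance : Category (RingMod R) where
  Hom M N := Hom M N
  id M :=
    { app := fun c => 𝟙 (M.obj c)
      comm := fun α => by simp }
  comp f g :=
    { app := fun c => f.app c ≫ g.app c
      comm := fun α => by
        rw [Functor.map_comp, ← Category.assoc, f.comm, Category.assoc, g.comm,
          Category.assoc] }
  id_comp f := Hom.ext (funext fun c => Category.id_comp (f.app c))
  comp_id f := Hom.ext (funext fun c => Category.comp_id (f.app c))
  assoc f g h := Hom.ext (funext fun c => Category.assoc (f.app c) (g.app c) (h.app c))

/-- The morphism `α_! M_c ⟶ M_d` adjoint to `M_α : M_c ⟶ α^* M_d`, that is,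
`M_c ⊗_{R_c} R_d ⟶ M_d`. -/
def adjointMap (M : RingMod R) {c d : C} (α : c ⟶ d) :
    (extendScalars (opMap R α)).obj (M.obj c) ⟶ M.obj d :=
  ((extendRestrictAdj (opMap R α)).homEquiv _ _).symm (M.map α)

/-- A right module `M` is cartesian if the morphism `α_! M_c ⟶ M_d` adjoint to `M_α` is an
isomorphism for every `α : c ⟶ d`. -/
def IsCartesian (R : C ⥤ RingCat.{u}) : ObjectProperty (RingMod R) :=
  fun M => ∀ ⦃c d : C⦄ (α : c ⟶ d), IsIso (M.adjointMap α)

end RingMod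

/-! ## The Yoneda functor -/

/-- The contravariant Yoneda functor `M ↦ Hom_A(-, M)`, restricted to finitely presented
modules. -/
def fpYoneda (A : Type u) [Ring A] : ModuleCat.{u} A ⥤ (FPMod A)ᵒᵖ ⥤ AddCommGrpCat.{u} :=
  preadditiveYoneda ⋙ (Functor.whiskeringLeft _ _ _).obj (isFP A).ι.op

instance fpYoneda_additive (A : Type u) [Ring A] (M : ModuleCat.{u} A) :
    ((fpYoneda A).obj M).Additive where
  map_add {X Y f g} := by
    ext h
    exact Preadditive.add_comp _ _ _ f.unop.hom g.unop.hom h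

/-- The natural homomorphism `Hom_A(F, φ^* N) → Hom_B(φ_! F, N)` of the adjunction `φ_! ⊣ φ^*`, for
`F` finitely presented. -/
def fpYonedaAdj {A B : Type u} [Ring A] [Ring B] (φ : A →+* B) (N : ModuleCat.{u} B) :
    (fpYoneda A).obj ((ModuleCat.restrictScalars φ).obj N) ⟶
      (fpExtend φ).op ⋙ (fpYoneda B).obj N where
  app F := AddCommGrpCat.ofHom (AddMonoidHom.mk'
    (fun f : F.unop.obj ⟶ (ModuleCat.restrictScalars φ).obj N =>
      (((extendRestrictAdj φ).homEquiv _ _).symm f :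
        (extendScalars φ).obj F.unop.obj ⟶ N))
    fun f g => extendRestrictAdj_symm_add φ f g)
  naturality F G f := by
    ext g
    exact (extendRestrictAdj φ).homEquiv_naturality_left_symm f.unop.hom g

theorem fpYonedaAdj_tmul {A B : Type u} [Ring A] [Ring B] (φ : A →+* B) (N : ModuleCat.{u} B)
    (F : FPMod A) (f : F.obj ⟶ (ModuleCat.restrictScalars φ).obj N) (b : B) (x : F.obj) :
    ModuleCat.Hom.hom (show (extendScalars φ).obj F.obj ⟶ N from (fpYonedaAdj φ N).app (op F) f)
      (BaseChange.tmul φ b x) = b • toSemilinear φ f x :=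
  extendRestrictAdj_symm_tmul φ f b x

/-- The levelwise Yoneda functor `Y : Mod-R ⥤ Mod-R_fp`, with `Y(M)_c = Hom(-, M_c)` on finitely
presented right `R_c`-modules and with `Y(M)_α` the composition
`Hom(-, M_c) ⟶ Hom(-, α^* M_d) ⟶ Hom(α_!(-), M_d)`. -/
def yonedaFP (R : C ⥤ RingCat.{u}) : RingMod R ⥤ (fpRep R).RightMod where
  obj M :=
    { obj := fun c => (fpYoneda (R.obj c)ᵐᵒᵖ).obj (M.obj c)
      additive := fun c => fpYoneda_additive _ _
      map := fun {c d} α => (fpYoneda (R.obj c)ᵐᵒᵖ).map (M.map α) ≫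
        fpYonedaAdj (opMap R α) (M.obj d)
      map_comp := fun {c d e α β γ} h F => by
        subst h
        ext f
        refine ModuleCat.hom_ext (BaseChange.hom_ext₂ fun x => ?_)
        change (((extendRestrictAdj (opMap R (α ≫ β))).homEquiv _ _).symm
            (f ≫ M.map (α ≫ β))).hom (BaseChange.compEquiv (opMap_comp R rfl) F.obj
              (BaseChange.tmul (opMap R β) 1 (BaseChange.tmul (opMap R α) 1 x))) =
          (((extendRestrictAdj (opMap R β)).homEquiv _ _).symm
            (((extendRestrictAdj (opMap R α)).homEquiv _ _).symm (f ≫ M.map α) ≫ M.map β)).hom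
              (BaseChange.tmul (opMap R β) 1 (BaseChange.tmul (opMap R α) 1 x))
        rw [BaseChange.compEquiv_tmul, map_one, mul_one]
        refine (extendRestrictAdj_symm_tmul _ _ _ _).trans ?_
        refine Eq.trans ?_ (extendRestrictAdj_symm_tmul _ _ _ _).symm
        rw [one_smul, one_smul]
        refine (M.map_comp α β _).trans ?_
        refine congrArg (toSemilinear _ (M.map β)) (Eq.symm ?_)
        exact (extendRestrictAdj_symm_tmul _ (f ≫ M.map α) _ _).trans (one_smul _ _)
      map_id := fun c F => by
        ext f
        refine ModuleCat.hom_ext (LinearMap.ext fun x => ?_)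
        refine (extendRestrictAdj_symm_tmul _ (f ≫ M.map (𝟙 c)) 1 x).trans ?_
        rw [one_smul]
        exact M.map_id c _ }
  map {M N} f :=
    { app := fun c => (fpYoneda (R.obj c)ᵐᵒᵖ).map (f.app c)
      comm := fun {c d} α => by
        ext F g
        refine ModuleCat.hom_ext (BaseChange.hom_ext fun x => ?_)
        refine (congrArg (f.app d).hom
          (extendRestrictAdj_symm_tmul _ (g ≫ M.map α) 1 x)).trans ?_
        refine Eq.trans ?_ (extendRestrictAdj_symm_tmul _ ((g ≫ f.app c) ≫ N.map α) 1 x).symm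
        rw [one_smul, one_smul]
        exact congrArg (fun k => toSemilinear _ k (ModuleCat.Hom.hom
          (show F.unop.obj ⟶ M.obj c from g) x)) (f.comm α) }
  map_id M := AddRep.RightMod.Hom.ext (funext fun c => (fpYoneda (R.obj c)ᵐᵒᵖ).map_id (M.obj c))
  map_comp f g := AddRep.RightMod.Hom.ext
    (funext fun c => (fpYoneda (R.obj c)ᵐᵒᵖ).map_comp (f.app c) (g.app c))

end Strict

end CartRep

end

noncomputable section

namespace CartRep

open CategoryTheory.Limits

/-! ### Finitely presented modules -/

section FinitelyPresented

variable {A : Type u} [Ring A]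

/-! The core is a statement about one ring `A`: the flat additive contravariant functors `P` on
finitely presented `A`-modules are exactly the functors `Hom(-, M)`, with `M = P(A)`.

Representables are flat (`isFlat_fpYoneda`). The finitely presented modules over `M` form a filtered
category. Hence every element of `Hom(-, M) ⊗ N` is a single tensor `f ⊗ y` with `f : F ⟶ M`, and it
vanishes only if `y` dies along some map `F ⟶ G` over `M`. Exactness then reduces to exactness at
`G`.

Flat functors are representable (`evalIso`). A right exact sequence `E → F → G → 0` makes `0 →
Hom(G, -) → Hom(F, -) → Hom(E, -)` exact. Tensoring with a flat `P` and using `P ⊗ Hom(s, -) ≅ P(s)`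
shows that `P` is left exact (`IsFlat.isLeftExact`). A natural map between left exact additive
functors is invertible once it is so at the ring (`IsLeftExact.bijective_of_bijective_self`), and
this applies to `P ⟶ Hom(-, P(A))`.

Full faithfulness holds because an element of `M` is a map `A ⟶ M`. Since `Hom(-, α^* N) ≅
Hom(α_!(-), N)`, structural morphisms on the functor side correspond to structural morphisms of
modules (`semiOf`), and the composition and identity laws are checked on elements at the ring.

For cartesian modules, `A_! Hom(-, M_c)` is again left exact because `Hom(-, M_c)` is flat. So its
map to `Hom(-, M_d)` is invertible as soon as it is so at `R_d`, where it becomes the adjoint map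
`α_! M_c ⟶ M_d` (`isIso_adjointHom_yonedaSemi_iff`). Thus `Y` both preserves and reflects being
cartesian, and the second equivalence is a restriction of the first. -/

instance (F : FPMod A) : Module.FinitePresentation A F.obj := F.property

/-- A module with an instance of finite presentation, as an object of `FPMod A`. -/
abbrev FPMod.of (A : Type u) [Ring A] (F : Type u) [AddCommGroup F] [Module A F]
    [h : Module.FinitePresentation A F] : FPMod A :=
  ⟨ModuleCat.of A F, h⟩

/-- The ring `A` as a finitely presented module over itself. -/
abbrev FPMod.self (A : Type u) [Ring A] : FPMod A := FPMod.of A A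

/-- The morphism of finitely presented modules given by a linear map. -/
abbrev FPMod.ofHom {F G : FPMod A} (f : F.obj →ₗ[A] G.obj) : F ⟶ G :=
  ObjectProperty.homMk (ModuleCat.ofHom f)

/-- The morphism `A ⟶ M`, `a ↦ a x`. -/
abbrev pointHom (M : ModuleCat.{u} A) (x : M) : ModuleCat.of A A ⟶ M :=
  ModuleCat.ofHom (LinearMap.toSpanSingleton A M x)

/-- The morphism `A ⟶ F` of finitely presented modules, `a ↦ a x`. -/
abbrev FPMod.point (F : FPMod A) (x : F.obj) : FPMod.self A ⟶ F :=
  ObjectProperty.homMk (pointHom F.obj x)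

theorem pointHom_comp {M M' : ModuleCat.{u} A} (x : M) (f : M ⟶ M') :
    pointHom M x ≫ f = pointHom M' (f.hom x) := by
  ext
  simp

theorem FPMod.point_comp {F G : FPMod A} (x : F.obj) (f : F ⟶ G) :
    F.point x ≫ f = G.point (f.hom.hom x) :=
  ObjectProperty.hom_ext _ (pointHom_comp x f.hom)

theorem pointHom_add (M : ModuleCat.{u} A) (x y : M) :
    pointHom M (x + y) = pointHom M x + pointHom M y := by
  ext
  simp

theorem eq_pointHom {M : ModuleCat.{u} A} (f : ModuleCat.of A A ⟶ M) :
    f = pointHom M (f.hom (1 : A)) := by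
  ext
  simp

/-- The quotient of a finitely presented module by a finitely generated submodule. -/
theorem finitePresentation_quotient (F : FPMod A) (K : Submodule A F.obj) (hK : K.FG) :
    Module.FinitePresentation A (F.obj ⧸ K) :=
  Module.finitePresentation_of_surjective K.mkQ K.mkQ_surjective (by rwa [Submodule.ker_mkQ])

/-- A morphism `f : F ⟶ M` from a finitely presented module, as an object over `M`. -/
abbrev fpOver {F : FPMod A} {M : ModuleCat.{u} A} (f : F.obj ⟶ M) :
    CostructuredArrow (isFP A).ι M :=
  CostructuredArrow.mk (S := (isFP A).ι) (Y := F) f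

/-- The category of finitely presented modules over `M` is filtered. -/
instance isFiltered_fpOver (M : ModuleCat.{u} A) :
    IsFiltered (CostructuredArrow (isFP A).ι M) where
  nonempty := ⟨fpOver (F := FPMod.self A) (pointHom M 0)⟩
  cocone_objs X Y := by
    let h : (FPMod.of A (X.left.obj × Y.left.obj)).obj ⟶ M :=
      ModuleCat.ofHom (LinearMap.coprod X.hom.hom Y.hom.hom)
    refine ⟨fpOver h,
      CostructuredArrow.homMk (FPMod.ofHom (LinearMap.inl A X.left.obj Y.left.obj)) ?_,
      CostructuredArrow.homMk (FPMod.ofHom (LinearMap.inr A X.left.obj Y.left.obj)) ?_, trivial⟩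
    · exact ModuleCat.hom_ext (LinearMap.coprod_inl _ _)
    · exact ModuleCat.hom_ext (LinearMap.coprod_inr _ _)
  cocone_maps X Y f g := by
    -- The coequalizing object is the cokernel of `f - g`. It is finitely presented because the
    -- image of `f - g` is finitely generated, and it lies over `M` because `f` and `g` agree after
    -- composition to `M`.
    let k : X.left.obj →ₗ[A] Y.left.obj := f.left.hom.hom - g.left.hom.hom
    have := finitePresentation_quotient Y.left (LinearMap.range k)
      (Submodule.fg_range _)
    have hk : LinearMap.range k ≤ LinearMap.ker Y.hom.hom := by
      rintro _ ⟨x, rfl⟩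
      have hf := congrArg (fun q => ModuleCat.Hom.hom q x) (CostructuredArrow.w f)
      have hg := congrArg (fun q => ModuleCat.Hom.hom q x) (CostructuredArrow.w g)
      change Y.hom.hom (f.left.hom.hom x - g.left.hom.hom x) = 0
      rw [map_sub, sub_eq_zero]
      exact hf.trans hg.symm
    let h : (FPMod.of A (Y.left.obj ⧸ LinearMap.range k)).obj ⟶ M :=
      ModuleCat.ofHom ((LinearMap.range k).liftQ Y.hom.hom hk)
    refine ⟨fpOver h,
      CostructuredArrow.homMk (FPMod.ofHom (LinearMap.range k).mkQ) ?_, ?_⟩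
    · ext x
      rfl
    · ext x
      refine (Submodule.Quotient.eq _).2 ⟨x, rfl⟩

end FinitelyPresented

/-! ### Flatness of representable modules -/

section Flat

variable {A : Type u} [Ring A] (M : ModuleCat.{u} A) (N : FPMod A ⥤ AddCommGrpCat.{u})

/-- The diagram of the groups `N(F)` over the finitely presented modules `F` over `M`. -/
abbrev fpOverDiagram : AsSmall.{u + 1} (CostructuredArrow (isFP A).ι M) ⥤ AddCommGrpCat.{u + 1} :=
  -- The indexing category has its objects in `Type (u + 1)`, so the groups are lifted to that
  -- universe for the colimit to exist.
  AsSmall.down ⋙ CostructuredArrow.proj _ _ ⋙ N ⋙ AddCommGrpCat.uliftFunctor.{u + 1, u}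

/-- The colimit of the groups `N(F)` over the finitely presented modules `F` over `M`. -/
abbrev fpOverColimit : AddCommGrpCat.{u + 1} :=
  colimit (fpOverDiagram M N)

variable {M} in
/-- The homomorphism from `N(F)` to the colimit of the groups `N(F)` at `f : F ⟶ M`. -/
def fpOverι {F : FPMod A} (f : F.obj ⟶ M) : N.obj F →+ fpOverColimit M N :=
  (colimit.ι (fpOverDiagram M N) ⟨fpOver f⟩).hom.comp
    AddEquiv.ulift.symm.toAddMonoidHom

variable {M N}

theorem fpOverι_map {F G : FPMod A} (g : F ⟶ G) (f : G.obj ⟶ M) (y : N.obj F) :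
    fpOverι N f (N.map g y) = fpOverι N (g.hom ≫ f) y := by
  let a : AsSmall.up.obj (fpOver (g.hom ≫ f)) ⟶
      AsSmall.up.obj (fpOver f) :=
    AsSmall.up.map (CostructuredArrow.homMk g rfl)
  exact congrArg (fun q => AddCommGrpCat.Hom.hom q (ULift.up y)) (colimit.w (fpOverDiagram M N) a)

/-- The maps `f`, `f'` and `f + f'` all factor through `(f, f') : F ⊕ F → M`, along `i`, `j` and `i
+ j`. At the single stage `F ⊕ F` the claim is `N(i + j) = N(i) + N(j)`. -/
theorem fpOverι_add [N.Additive] {F : FPMod A} (f f' : F.obj ⟶ M) (y : N.obj F) :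
    fpOverι N (f + f') y = fpOverι N f y + fpOverι N f' y := by
  let G := FPMod.of A (F.obj × F.obj)
  let h : G.obj ⟶ M := ModuleCat.ofHom (LinearMap.coprod f.hom f'.hom)
  let i : F ⟶ G := FPMod.ofHom (LinearMap.inl A F.obj F.obj)
  let j : F ⟶ G := FPMod.ofHom (LinearMap.inr A F.obj F.obj)
  have hi : i.hom ≫ h = f := ModuleCat.hom_ext (LinearMap.coprod_inl _ _)
  have hj : j.hom ≫ h = f' := ModuleCat.hom_ext (LinearMap.coprod_inr _ _)
  have hij : (i + j).hom ≫ h = f + f' := by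
    rw [← hi, ← hj]
    exact Preadditive.add_comp _ _ _ i.hom j.hom h
  rw [← hij, ← hi, ← hj, ← fpOverι_map, ← fpOverι_map, ← fpOverι_map, N.map_add, ← map_add]
  rfl

/-- In a filtered colimit an element vanishes only if it already vanishes at a later stage, and a
later stage of `f` is a factorization of `f` through a finitely presented module. -/
theorem exists_map_eq_zero_of_fpOverι_eq_zero {F : FPMod A} (f : F.obj ⟶ M) (y : N.obj F)
    (h : fpOverι N f y = 0) :
    ∃ (G : FPMod A) (g : F ⟶ G) (f' : G.obj ⟶ M), g.hom ≫ f' = f ∧ N.map g y = 0 := by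
  have h' : (colimit.ι (fpOverDiagram M N) ⟨fpOver f⟩) ⟨y⟩ =
      (colimit.ι (fpOverDiagram M N) ⟨fpOver f⟩) 0 := by
    rw [map_zero]
    exact h
  obtain ⟨k, a, ha⟩ := ((colimit.isColimit (fpOverDiagram M N)).eq_iff' _ _).1 h'
  rw [map_zero] at ha
  exact ⟨(ULift.down k).left, (ULift.down a).left, (ULift.down k).hom,
    CostructuredArrow.w (ULift.down a), congrArg ULift.down ha⟩

/-- The homomorphism from `Hom(-, M) ⊗ N` to the colimit of the groups `N(F)` over all finitely
presented modules `F` over `M`. -/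
def tensorToColimit (M : ModuleCat.{u} A) (N : FPMod A ⥤ AddCommGrpCat.{u}) [N.Additive] :
    Tensor ((fpYoneda A).obj M) N →+ fpOverColimit M N :=
  Tensor.lift
    (fun F => AddMonoidHom.mk' (fun f : F.obj ⟶ M => fpOverι N f)
      fun f f' => AddMonoidHom.ext fun y => fpOverι_add f f' y)
    fun _ _ r _ y => (fpOverι_map r _ y).symm

/-- The element `f ⊗ y` of `Hom(-, M) ⊗ N`, for `f : F ⟶ M` and `y ∈ N(F)`. -/
def homTmul {F : FPMod A} (f : F.obj ⟶ M) (y : N.obj F) : Tensor ((fpYoneda A).obj M) N :=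
  Tensor.tmul (M := (fpYoneda A).obj M) F f y

/-- This is the flatness criterion for `Hom(-, M)`. The tensor product is in fact the colimit, but a
homomorphism to the colimit is enough, since the colimit only serves to detect vanishing. -/
theorem exists_map_eq_zero_of_homTmul_eq_zero [N.Additive] {F : FPMod A} (f : F.obj ⟶ M)
    (y : N.obj F) (h : homTmul f y = 0) :
    ∃ (G : FPMod A) (g : F ⟶ G) (f' : G.obj ⟶ M), g.hom ≫ f' = f ∧ N.map g y = 0 := by
  refine exists_map_eq_zero_of_fpOverι_eq_zero f y ?_
  have h' := congrArg (tensorToColimit M N) h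
  rw [map_zero] at h'
  exact (Tensor.lift_tmul _ _ _ _ _).symm.trans h'

end Flat

/-! ### Tensor products over preadditive categories -/

section Tensor

variable {A : Type w} [Category.{v} A] {M : Aᵒᵖ ⥤ AddCommGrpCat.{v}}
  {N N' N'' : A ⥤ AddCommGrpCat.{v}}

theorem Tensor.induction_on {p : Tensor M N → Prop} (t : Tensor M N) (zero : p 0)
    (tmul : ∀ (a : A) (x : M.obj (op a)) (y : N.obj a), p (Tensor.tmul a x y))
    (add : ∀ s t, p s → p t → p (s + t)) : p t := by
  classical
  obtain ⟨t, rfl⟩ := QuotientAddGroup.mk_surjective (s := tensorRel M N) t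
  induction t using DirectSum.induction_on with
  | zero => exact zero
  | of a t =>
    induction t using TensorProduct.induction_on with
    | zero => rw [map_zero]; exact zero
    | tmul x y => exact tmul a x y
    | add s t hs ht => rw [map_add]; exact add _ _ hs ht
  | add s t hs ht => exact add _ _ hs ht

theorem Tensor.tmul_zero (a : A) (x : M.obj (op a)) :
    (Tensor.tmul a x 0 : Tensor M N) = 0 := by
  have h := Tensor.tmul_add (N := N) a x 0 0
  rw [add_zero] at h
  exact left_eq_add.1 h

theorem Tensor.map_surjective (g : N ⟶ N') (hg : ∀ a, Function.Surjective (g.app a)) :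
    Function.Surjective (Tensor.map M g) := by
  intro t
  induction t using Tensor.induction_on with
  | zero => exact ⟨0, map_zero _⟩
  | tmul a x y =>
    obtain ⟨z, rfl⟩ := hg a y
    exact ⟨Tensor.tmul a x z, Tensor.map_tmul g a x z⟩
  | add s t hs ht =>
    obtain ⟨s, rfl⟩ := hs
    obtain ⟨t, rfl⟩ := ht
    exact ⟨s + t, map_add _ _ _⟩

end Tensor

/-! ### Quotients of left modules -/

section Quotient

variable {A : Type w} [Category.{v} A] {N₁ N₂ N₃ : A ⥤ AddCommGrpCat.{v}}

/-- The cokernel of a morphism of left modules, formed objectwise. -/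
def quotModule (f : N₁ ⟶ N₂) : A ⥤ AddCommGrpCat.{v} where
  obj a := AddCommGrpCat.of (N₂.obj a ⧸ (f.app a).hom.range)
  map {a b} r := AddCommGrpCat.ofHom (QuotientAddGroup.map _ _ (N₂.map r).hom (by
    rintro _ ⟨x, rfl⟩
    exact ⟨N₁.map r x, NatTrans.naturality_apply f r x⟩))
  map_id a := by
    ext x
    exact congrArg (QuotientAddGroup.mk (s := (f.app a).hom.range))
      (ConcreteCategory.congr_hom (N₂.map_id a) x)
  map_comp {a b c} r s := by
    ext x
    exact congrArg (QuotientAddGroup.mk (s := (f.app c).hom.range))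
      (ConcreteCategory.congr_hom (N₂.map_comp r s) x)

instance [Preadditive A] [N₂.Additive] (f : N₁ ⟶ N₂) : (quotModule f).Additive where
  map_add {a b r s} := by
    ext x
    obtain ⟨x, rfl⟩ := QuotientAddGroup.mk_surjective (s := (f.app a).hom.range) x
    exact congrArg (QuotientAddGroup.mk (s := (f.app b).hom.range))
      (ConcreteCategory.congr_hom (N₂.map_add (f := r) (g := s)) x)

/-- The projection onto the cokernel. -/
def quotModuleπ (f : N₁ ⟶ N₂) : N₂ ⟶ quotModule f where
  app a := AddCommGrpCat.ofHom (QuotientAddGroup.mk' (f.app a).hom.range)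

/-- The morphism out of the cokernel of `f` induced by a morphism that vanishes on the image of
`f`. -/
def quotModuleDesc (f : N₁ ⟶ N₂) (g : N₂ ⟶ N₃) (h : ∀ a x, g.app a (f.app a x) = 0) :
    quotModule f ⟶ N₃ where
  app a := AddCommGrpCat.ofHom (QuotientAddGroup.lift (f.app a).hom.range (g.app a).hom (by
    rintro _ ⟨x, rfl⟩
    exact h a x))
  naturality a b r := by
    ext x
    obtain ⟨x, rfl⟩ := QuotientAddGroup.mk_surjective (s := (f.app a).hom.range) x
    exact NatTrans.naturality_apply g r x

theorem quotModuleπ_desc (f : N₁ ⟶ N₂) (g : N₂ ⟶ N₃) (h : ∀ a x, g.app a (f.app a x) = 0) :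
    quotModuleπ f ≫ quotModuleDesc f g h = g := by
  ext a x
  rfl

theorem isShortExact_quotModule (f : N₁ ⟶ N₂) (hf : ∀ a, Function.Injective (f.app a)) :
    IsShortExact f (quotModuleπ f) where
  injective := hf
  exact _ x := QuotientAddGroup.eq_zero_iff x
  surjective _ := QuotientAddGroup.mk_surjective

variable [Preadditive A] [N₁.Additive] [N₂.Additive] [N₃.Additive]

/-- Tensoring with a flat module preserves monomorphisms. -/
theorem IsFlat.map_injective {M : Aᵒᵖ ⥤ AddCommGrpCat.{v}} (hM : IsFlat M) (f : N₁ ⟶ N₂)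
    (hf : ∀ a, Function.Injective (f.app a)) : Function.Injective (Tensor.map M f) :=
  (hM _ _ _ f _ (isShortExact_quotModule f hf)).1

/-- Tensoring with a flat module is left exact. -/
theorem IsFlat.map_exact {M : Aᵒᵖ ⥤ AddCommGrpCat.{v}} (hM : IsFlat M) (f : N₁ ⟶ N₂)
    (g : N₂ ⟶ N₃) (hf : ∀ a, Function.Injective (f.app a))
    (hfg : ∀ a, Function.Exact (f.app a) (g.app a)) :
    Function.Exact (Tensor.map M f) (Tensor.map M g) := by
  have h₀ : ∀ a x, g.app a (f.app a x) = 0 := fun a x => (hfg a).apply_apply_eq_zero x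
  -- Flatness speaks of short exact sequences only, so `g` is factored as the projection to the
  -- cokernel of `f` followed by a map to `N₃`, injective by exactness at `N₂`. That map stays
  -- injective after tensoring, so `M ⊗ g` has the same kernel as `M ⊗` the projection.
  have hι : ∀ a, Function.Injective ((quotModuleDesc f g h₀).app a) := by
    intro a
    refine (injective_iff_map_eq_zero _).2 fun x hx => ?_
    obtain ⟨x, rfl⟩ := QuotientAddGroup.mk_surjective (s := (f.app a).hom.range) x
    exact (QuotientAddGroup.eq_zero_iff x).2 ((hfg a x).1 hx)
  have hι' := hM.map_injective _ hι
  intro t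
  rw [← (hM _ _ _ f _ (isShortExact_quotModule f hf)).2.1 t, ← quotModuleπ_desc f g h₀,
    Tensor.map_comp]
  exact map_eq_zero_iff _ hι'

end Quotient

/-! ### Flatness of representable modules -/

section Flat

variable {A : Type u} [Ring A] {M : ModuleCat.{u} A} {N N' : FPMod A ⥤ AddCommGrpCat.{u}}

theorem homTmul_comp {F G : FPMod A} (g : F ⟶ G) (f : G.obj ⟶ M) (y : N.obj F) :
    homTmul (g.hom ≫ f) y = homTmul f (N.map g y) :=
  Tensor.tmul_rel (M := (fpYoneda A).obj M) g f y

theorem homTmul_add {F : FPMod A} (f : F.obj ⟶ M) (y z : N.obj F) :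
    homTmul f (y + z) = homTmul f y + homTmul f z :=
  Tensor.tmul_add (M := (fpYoneda A).obj M) F f y z

theorem homTmul_zero {F : FPMod A} (f : F.obj ⟶ M) : homTmul f (0 : N.obj F) = 0 :=
  Tensor.tmul_zero (M := (fpYoneda A).obj M) F f

theorem map_homTmul (g : N ⟶ N') {F : FPMod A} (f : F.obj ⟶ M) (y : N.obj F) :
    Tensor.map ((fpYoneda A).obj M) g (homTmul f y) = homTmul f (g.app F y) :=
  Tensor.map_tmul (M := (fpYoneda A).obj M) g F f y

/-- Finite direct sums of finitely presented modules make every tensor pure: `f ⊗ y + g ⊗ z = (f, g)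
⊗ (i y + j z)`, where `i` and `j` are the inclusions into `F ⊕ G`. -/
theorem exists_eq_homTmul (t : Tensor ((fpYoneda A).obj M) N) :
    ∃ (F : FPMod A) (f : F.obj ⟶ M) (y : N.obj F), t = homTmul f y := by
  induction t using Tensor.induction_on with
  | zero => exact ⟨FPMod.self A, 0, 0, (homTmul_zero _).symm⟩
  | tmul a x y => exact ⟨a, x, y, rfl⟩
  | add s t hs ht =>
    obtain ⟨F, f, y, rfl⟩ := hs
    obtain ⟨G, g, z, rfl⟩ := ht
    let H := FPMod.of A (F.obj × G.obj)
    let h : H.obj ⟶ M := ModuleCat.ofHom (LinearMap.coprod f.hom g.hom)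
    let i : F ⟶ H := FPMod.ofHom (LinearMap.inl A F.obj G.obj)
    let j : G ⟶ H := FPMod.ofHom (LinearMap.inr A F.obj G.obj)
    have hi : i.hom ≫ h = f := ModuleCat.hom_ext (LinearMap.coprod_inl _ _)
    have hj : j.hom ≫ h = g := ModuleCat.hom_ext (LinearMap.coprod_inr _ _)
    refine ⟨H, h, N.map i y + N.map j z, ?_⟩
    rw [← hi, ← hj, homTmul_comp, homTmul_comp, homTmul_add]

/-- The module `Hom(-, M)` over the category of finitely presented modules is flat. -/
theorem isFlat_fpYoneda (M : ModuleCat.{u} A) : IsFlat ((fpYoneda A).obj M) := by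
  intro N₁ N₂ N₃ _ _ _ i p h
  refine ⟨(injective_iff_map_eq_zero _).2 fun t ht => ?_, fun t => ⟨fun ht => ?_, ?_⟩,
    Tensor.map_surjective p h.surjective⟩
  -- If `f ⊗ i(y)` vanishes, then `i(y)` dies along some `g : F ⟶ G` over `M`. By naturality `i`
  -- kills `N₁(g)(y)`, so this element is zero, and `f ⊗ y = f' ⊗ N₁(g)(y)`. Exactness in the middle
  -- follows by the same passage to `G`.
  · obtain ⟨F, f, y, rfl⟩ := exists_eq_homTmul t
    rw [map_homTmul] at ht
    obtain ⟨G, g, f', rfl, hy⟩ := exists_map_eq_zero_of_homTmul_eq_zero _ _ ht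
    rw [← NatTrans.naturality_apply] at hy
    rw [homTmul_comp, (map_eq_zero_iff _ (h.injective G)).1 hy, homTmul_zero]
  · obtain ⟨F, f, y, rfl⟩ := exists_eq_homTmul t
    rw [map_homTmul] at ht
    obtain ⟨G, g, f', rfl, hy⟩ := exists_map_eq_zero_of_homTmul_eq_zero _ _ ht
    rw [← NatTrans.naturality_apply] at hy
    obtain ⟨z, hz⟩ := (h.exact G _).1 hy
    refine ⟨homTmul f' z, ?_⟩
    rw [map_homTmul, hz, homTmul_comp]
  · rintro ⟨t, rfl⟩
    induction t using Tensor.induction_on with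
    | zero => rw [map_zero, map_zero]
    | tmul a x y =>
      rw [Tensor.map_tmul, Tensor.map_tmul, (h.exact a).apply_apply_eq_zero, Tensor.tmul_zero]
    | add s t hs ht => rw [map_add, map_add, hs, ht, add_zero]

end Flat

/-! ### Left exact modules over the category of finitely presented modules -/

section LeftExact

universe t t'

variable {A : Type u} [Ring A]

/-- A contravariant functor on finitely presented modules is left exact if it sends right exact
sequences `E → F → G → 0` to left exact sequences. -/
structure IsLeftExact (P : (FPMod A)ᵒᵖ ⥤ AddCommGrpCat.{t}) : Prop where
  injective {F G : FPMod A} (p : F ⟶ G) (hp : Function.Surjective p.hom.hom) :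
    Function.Injective (P.map p.op)
  exact {E F G : FPMod A} (q : E ⟶ F) (p : F ⟶ G) (hp : Function.Surjective p.hom.hom)
    (hq : Function.Exact q.hom.hom p.hom.hom) : Function.Exact (P.map p.op) (P.map q.op)

variable {P : (FPMod A)ᵒᵖ ⥤ AddCommGrpCat.{t}} {Q : (FPMod A)ᵒᵖ ⥤ AddCommGrpCat.{t'}}

/-- Left exactness is invariant under isomorphism. -/
theorem IsLeftExact.of_bijective (hP : IsLeftExact P)
    (τ : ∀ F : FPMod A, P.obj (op F) →+ Q.obj (op F))
    (hτ : ∀ {F G : FPMod A} (f : F ⟶ G) x, τ F (P.map f.op x) = Q.map f.op (τ G x))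
    (h : ∀ F, Function.Bijective (τ F)) : IsLeftExact Q where
  injective {F G} p hp := by
    refine (injective_iff_map_eq_zero _).2 fun y hy => ?_
    obtain ⟨x, rfl⟩ := (h G).2 y
    rw [← hτ, map_eq_zero_iff _ (h F).1, map_eq_zero_iff _ (hP.injective p hp)] at hy
    rw [hy, map_zero]
  exact {E F G} q p hp hq y := by
    obtain ⟨x, rfl⟩ := (h F).2 y
    rw [← hτ, map_eq_zero_iff _ (h E).1, hP.exact q p hp hq x]
    constructor
    · rintro ⟨z, rfl⟩
      exact ⟨τ G z, (hτ p z).symm⟩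
    · rintro ⟨z, hz⟩
      obtain ⟨z, rfl⟩ := (h G).2 z
      exact ⟨z, (h F).1 ((hτ p z).trans hz)⟩

/-- The free module on `n` generators. -/
abbrev FPMod.free (A : Type u) [Ring A] (n : ℕ) : FPMod A := FPMod.of A (Fin n → A)

/-- The inclusion of the `i`-th summand of the free module. -/
abbrev FPMod.freeι {n : ℕ} (i : Fin n) : FPMod.self A ⟶ FPMod.free A n :=
  FPMod.ofHom (F := FPMod.self A) (G := FPMod.free A n) (LinearMap.single A (fun _ => A) i)

/-- The projection to the `i`-th summand of the free module. -/
abbrev FPMod.freeπ {n : ℕ} (i : Fin n) : FPMod.free A n ⟶ FPMod.self A :=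
  FPMod.ofHom (F := FPMod.free A n) (G := FPMod.self A) (LinearMap.proj i)

theorem FPMod.sum_freeπ_freeι (n : ℕ) :
    ∑ i : Fin n, FPMod.freeπ i ≫ FPMod.freeι (A := A) i = 𝟙 (FPMod.free A n) := by
  apply (isFP A).hom_ext
  rw [← ObjectProperty.ι_map, Functor.map_sum]
  refine ModuleCat.hom_ext (LinearMap.ext fun x => ?_)
  rw [ModuleCat.hom_sum, LinearMap.sum_apply]
  exact Finset.univ_sum_single x

theorem eq_sum_free [P.Additive] (n : ℕ) (x : P.obj (op (FPMod.free A n))) :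
    x = ∑ i, P.map (FPMod.freeπ i).op (P.map (FPMod.freeι i).op x) := by
  have h := congrArg (fun f => P.map (Quiver.Hom.op f)) (FPMod.sum_freeπ_freeι (A := A) n)
  simp only [op_sum, Functor.map_sum, op_comp, Functor.map_comp, op_id, P.map_id] at h
  let ev : (P.obj (op (FPMod.free A n)) ⟶ P.obj (op (FPMod.free A n))) →+
      P.obj (op (FPMod.free A n)) := AddMonoidHom.mk' (fun f => f.hom x) fun _ _ => rfl
  exact ((map_sum ev _ _).symm.trans (congrArg ev h)).symm

/-- An additive functor sends `A^n` to `P(A)^n`, through the inclusions and projections. Here `τ` is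
a family of homomorphisms rather than a natural transformation because `P` and `Q` may take values
in different universes, as an extension of scalars and its target do. -/
theorem bijective_free_of_bijective_self [P.Additive] [Q.Additive]
    (τ : ∀ F : FPMod A, P.obj (op F) →+ Q.obj (op F))
    (hτ : ∀ {F G : FPMod A} (f : F ⟶ G) x, τ F (P.map f.op x) = Q.map f.op (τ G x))
    (h : Function.Bijective (τ (FPMod.self A))) (n : ℕ) :
    Function.Bijective (τ (FPMod.free A n)) := by
  refine ⟨(injective_iff_map_eq_zero _).2 fun x hx => ?_, fun y => ?_⟩
  · rw [eq_sum_free n x]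
    refine Finset.sum_eq_zero fun i _ => ?_
    have h0 : P.map (FPMod.freeι i).op x = 0 :=
      (map_eq_zero_iff _ h.1).1 (by rw [hτ, hx, map_zero])
    rw [h0, map_zero]
  · choose x hx using fun i : Fin n => h.2 (Q.map (FPMod.freeι i).op y)
    refine ⟨∑ i, P.map (FPMod.freeπ i).op (x i), ?_⟩
    rw [map_sum, eq_sum_free n y]
    refine Finset.sum_congr rfl fun i _ => ?_
    rw [hτ, hx]

/-- A natural transformation between left exact functors on finitely presented modules is an
isomorphism if it is one at the ring. -/
theorem IsLeftExact.bijective_of_bijective_self [P.Additive] [Q.Additive] (hP : IsLeftExact P)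
    (hQ : IsLeftExact Q) (τ : ∀ F : FPMod A, P.obj (op F) →+ Q.obj (op F))
    (hτ : ∀ {F G : FPMod A} (f : F ⟶ G) x, τ F (P.map f.op x) = Q.map f.op (τ G x))
    (h : Function.Bijective (τ (FPMod.self A))) (F : FPMod A) : Function.Bijective (τ F) := by
  -- A presentation `A^m → A^n → F → 0` gives left exact rows starting at `P(F)` and `Q(F)`. Since
  -- `τ` is bijective at `A^n` and `A^m`, a diagram chase gives bijectivity at `F`.
  obtain ⟨n, m, p, q, hp, hq⟩ := Module.FinitePresentation.exists_fin' A F.obj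
  have hn := bijective_free_of_bijective_self τ hτ h n
  have hm := bijective_free_of_bijective_self τ hτ h m
  let p' : FPMod.free A n ⟶ F := FPMod.ofHom (F := FPMod.free A n) p
  let q' : FPMod.free A m ⟶ FPMod.free A n :=
    FPMod.ofHom (F := FPMod.free A m) (G := FPMod.free A n) q
  refine ⟨(injective_iff_map_eq_zero _).2 fun x hx => ?_, fun y => ?_⟩
  · have h0 : τ _ (P.map p'.op x) = 0 := by rw [hτ, hx, map_zero]
    exact (map_eq_zero_iff _ (hP.injective p' hp)).1 ((map_eq_zero_iff _ hn.1).1 h0)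
  · obtain ⟨z, hz⟩ := hn.2 (Q.map p'.op y)
    have h0 : P.map q'.op z = 0 := (map_eq_zero_iff _ hm.1).1 (by
      rw [hτ, hz]
      exact (hQ.exact q' p' hp hq).apply_apply_eq_zero y)
    obtain ⟨x, rfl⟩ := (hP.exact q' p' hp hq z).1 h0
    exact ⟨x, hQ.injective p' hp ((hτ p' x).symm.trans hz)⟩

end LeftExact

/-! ### Flat modules are left exact -/

section FlatLeftExact

instance extendModule_additive {A B : Type w} [Category.{v} A] [Category.{v} B] [Preadditive B]
    (φ : A ⥤ B) (M : Aᵒᵖ ⥤ AddCommGrpCat.{v}) : (extendModule φ M).Additive where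
  map_add {s t f g} := by
    ext1
    refine Tensor.hom_ext fun a x y => ?_
    change Tensor.map M _ (Tensor.tmul a x y) =
      Tensor.map M (Functor.whiskerLeft φ (preadditiveCoyoneda.map f)) (Tensor.tmul a x y) +
        Tensor.map M (Functor.whiskerLeft φ (preadditiveCoyoneda.map g)) (Tensor.tmul a x y)
    rw [Tensor.map_tmul, Tensor.map_tmul, Tensor.map_tmul, ← Tensor.tmul_add]
    exact congrArg (Tensor.tmul a x)
      (Preadditive.add_comp _ _ _ f.unop g.unop (show s.unop ⟶ φ.obj a from y))

/-! ### Left exactness of `Hom(-, H)` on finitely presented modules. -/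

section Precomp

variable {B : Type u} [Ring B] {E F G H : FPMod B}

theorem FPMod.precomp_injective (p : F ⟶ G) (hp : Function.Surjective p.hom.hom) {f g : G ⟶ H}
    (h : p ≫ f = p ≫ g) : f = g := by
  apply (isFP B).hom_ext
  refine ModuleCat.hom_ext (LinearMap.ext fun x => ?_)
  obtain ⟨y, rfl⟩ := hp x
  exact congrArg (fun k : F ⟶ H => k.hom.hom y) h

theorem FPMod.precomp_exact (q : E ⟶ F) (p : F ⟶ G) (hp : Function.Surjective p.hom.hom)
    (hq : Function.Exact q.hom.hom p.hom.hom) (f : F ⟶ H) :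
    q ≫ f = 0 ↔ ∃ g : G ⟶ H, p ≫ g = f := by
  constructor
  · intro h
    have hf : LinearMap.ker p.hom.hom ≤ LinearMap.ker f.hom.hom := by
      intro x hx
      obtain ⟨y, rfl⟩ := (hq x).1 hx
      exact congrArg (fun k : E ⟶ H => k.hom.hom y) h
    refine ⟨FPMod.ofHom (((LinearMap.ker p.hom.hom).liftQ f.hom.hom hf).comp
      (p.hom.hom.quotKerEquivOfSurjective hp).symm.toLinearMap), ?_⟩
    apply (isFP B).hom_ext
    refine ModuleCat.hom_ext (LinearMap.ext fun x => ?_)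
    change ((LinearMap.ker p.hom.hom).liftQ f.hom.hom hf)
      ((p.hom.hom.quotKerEquivOfSurjective hp).symm (p.hom.hom x)) = f.hom.hom x
    have hx : (p.hom.hom.quotKerEquivOfSurjective hp).symm (p.hom.hom x) =
        Submodule.Quotient.mk x := by
      rw [LinearEquiv.symm_apply_eq]
      rfl
    rw [hx]
    rfl
  · rintro ⟨g, rfl⟩
    apply (isFP B).hom_ext
    refine ModuleCat.hom_ext (LinearMap.ext fun x => ?_)
    change g.hom.hom (p.hom.hom (q.hom.hom x)) = 0
    rw [hq.apply_apply_eq_zero, map_zero]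

end Precomp

/-- An extension of scalars of a flat module is left exact. -/
theorem IsFlat.isLeftExact_extendModule {A : Type (u + 1)} [Category.{u} A] [Preadditive A]
    {B : Type u} [Ring B] (φ : A ⥤ FPMod B) [φ.Additive] {M : Aᵒᵖ ⥤ AddCommGrpCat.{u}}
    (hM : IsFlat M) : IsLeftExact (extendModule φ M) where
  injective p hp :=
    -- A right exact sequence in the variable `s` becomes a left exact sequence of left `A`-modules
    -- `Hom_B(s, φ(-))`, which `M ⊗ -` preserves.
    hM.map_injective _ fun _ _ _ h => FPMod.precomp_injective p hp h
  exact q p hp hq :=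
    hM.map_exact _ _ (fun _ _ _ h => FPMod.precomp_injective p hp h)
      fun _ f => FPMod.precomp_exact q p hp hq f

theorem adjointApp_naturality {A B : Type w} [Category.{v} A] [Category.{v} B] [Preadditive B]
    (φ : A ⥤ B) {M : Aᵒᵖ ⥤ AddCommGrpCat.{v}} {N : Bᵒᵖ ⥤ AddCommGrpCat.{v}} [N.Additive]
    (F : M ⟶ φ.op ⋙ N) {s t : B} (f : s ⟶ t) (x : (extendModule φ M).obj (op t)) :
    adjointApp φ F s ((extendModule φ M).map f.op x) = N.map f.op (adjointApp φ F t x) :=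
  congrArg ULift.down (NatTrans.naturality_apply (adjointHom φ F) f.op x)

/-- The isomorphism `M ⊗_A Hom_A(s, -) ≅ M(s)`. -/
theorem bijective_adjointApp_id {A : Type w} [Category.{v} A] [Preadditive A]
    {M : Aᵒᵖ ⥤ AddCommGrpCat.{v}} [M.Additive] (F : M ⟶ (𝟭 A).op ⋙ M)
    (hF : ∀ a x, F.app a x = x) (s : A) : Function.Bijective (adjointApp (𝟭 A) F s) := by
  -- The inverse is `x ↦ x ⊗ 𝟙`, because balancing along `y : s ⟶ a` gives `x ⊗ y = M(y)(x) ⊗ 𝟙`.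
  let σ : M.obj (op s) →+ Tensor M (homModule (𝟭 A) s) :=
    AddMonoidHom.mk' (fun x => Tensor.tmul (N := homModule (𝟭 A) s) s x (𝟙 s))
      fun x x' => Tensor.add_tmul s x x' _
  have hσ : σ.comp (adjointApp (𝟭 A) F s) = AddMonoidHom.id _ := by
    refine Tensor.hom_ext fun a x y => ?_
    change σ (adjointApp (𝟭 A) F s (Tensor.tmul a x y)) = Tensor.tmul a x y
    refine (congrArg σ (adjointApp_tmul (𝟭 A) F s a x y)).trans ?_
    rw [hF]
    refine (Tensor.tmul_rel (N := homModule (𝟭 A) s) (show s ⟶ a from y) x (𝟙 s)).trans ?_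
    exact congrArg (Tensor.tmul a x) (Category.id_comp (show s ⟶ a from y))
  refine Function.bijective_iff_has_inverse.2 ⟨σ, DFunLike.congr_fun hσ, fun x => ?_⟩
  refine (adjointApp_tmul (𝟭 A) F s s x (𝟙 s)).trans ?_
  rw [hF]
  exact ConcreteCategory.congr_hom (M.map_id (op s)) x

/-- A flat module over the category of finitely presented modules is left exact. -/
theorem IsFlat.isLeftExact {A : Type u} [Ring A] {M : (FPMod A)ᵒᵖ ⥤ AddCommGrpCat.{u}}
    [M.Additive] (hM : IsFlat M) : IsLeftExact M :=
  -- By co-Yoneda, `M` is its own extension of scalars along the identity functor.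
  IsLeftExact.of_bijective (hM.isLeftExact_extendModule (𝟭 (FPMod A)))
    (fun F => adjointApp (𝟭 (FPMod A)) (M := M) { app := fun _ => 𝟙 _ } F)
    (fun f x => adjointApp_naturality _ _ f x)
    (fun F => bijective_adjointApp_id _ (fun _ _ => rfl) F)

end FlatLeftExact

/-! ### Flat modules are representable -/

section Representable

variable {A : Type u} [Ring A]

theorem FPMod.point_add (F : FPMod A) (x y : F.obj) :
    F.point (x + y) = F.point x + F.point y :=
  (isFP A).hom_ext (pointHom_add F.obj x y)

theorem FPMod.point_self_comp (F : FPMod A) (a : A) (x : F.obj) :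
    (FPMod.self A).point a ≫ F.point x = F.point (a • x) := by
  rw [FPMod.point_comp]
  rfl

theorem FPMod.point_one : (FPMod.self A).point (1 : A) = 𝟙 (FPMod.self A) :=
  (isFP A).hom_ext (eq_pointHom (𝟙 (ModuleCat.of A A))).symm

/-- The value at the ring of a contravariant functor on finitely presented modules. -/
def SelfValue (P : (FPMod A)ᵒᵖ ⥤ AddCommGrpCat.{u}) : Type u := P.obj (op (FPMod.self A))

variable (P : (FPMod A)ᵒᵖ ⥤ AddCommGrpCat.{u})

instance : AddCommGroup (SelfValue P) :=
  inferInstanceAs (AddCommGroup (P.obj (op (FPMod.self A))))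

/-- The ring acts on `P(A)` through its right multiplications. -/
instance [P.Additive] : Module A (SelfValue P) where
  smul a m := P.map ((FPMod.self A).point a).op m
  one_smul m := by
    change P.map ((FPMod.self A).point 1).op m = m
    rw [FPMod.point_one]
    exact ConcreteCategory.congr_hom (P.map_id _) m
  mul_smul a b m := by
    change P.map ((FPMod.self A).point (a • b)).op m =
      P.map ((FPMod.self A).point a).op (P.map ((FPMod.self A).point b).op m)
    rw [← FPMod.point_self_comp]
    exact ConcreteCategory.congr_hom (P.map_comp _ _) m
  smul_zero a := map_zero (P.map ((FPMod.self A).point a).op).hom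
  smul_add a := map_add (P.map ((FPMod.self A).point a).op).hom
  add_smul a b m := by
    change P.map ((FPMod.self A).point (a + b)).op m =
      P.map ((FPMod.self A).point a).op m + P.map ((FPMod.self A).point b).op m
    rw [FPMod.point_add]
    exact ConcreteCategory.congr_hom
      (P.map_add (f := ((FPMod.self A).point a).op) (g := ((FPMod.self A).point b).op)) m
  zero_smul m := by
    change P.map ((FPMod.self A).point 0).op m = 0
    have h : ((FPMod.self A).point (0 : A)).op = 0 :=
      congrArg Quiver.Hom.op ((isFP A).hom_ext (by ext; simp) :
        (FPMod.self A).point (0 : A) = 0)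
    rw [h, P.map_zero]
    rfl

variable [P.Additive]

/-- The module `P(A)`. -/
abbrev selfValue : ModuleCat.{u} A := ModuleCat.of A (SelfValue P)

/-- The homomorphism `P(F) → Hom_A(F, P(A))`. -/
def evalHom (F : FPMod A) : P.obj (op F) →+ ((fpYoneda A).obj (selfValue P)).obj (op F) :=
  AddMonoidHom.mk'
    (fun s => show F.obj ⟶ selfValue P from ModuleCat.ofHom
      { toFun := fun x => P.map (F.point x).op s
        map_add' := fun x y => by
          rw [FPMod.point_add]
          exact ConcreteCategory.congr_hom
            (P.map_add (f := (F.point x).op) (g := (F.point y).op)) s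
        map_smul' := fun a x => by
          rw [← FPMod.point_self_comp]
          exact ConcreteCategory.congr_hom (P.map_comp _ _) s })
    fun s t => ModuleCat.hom_ext (LinearMap.ext fun x => map_add (P.map (F.point x).op).hom s t)

theorem evalHom_naturality {F G : FPMod A} (f : F ⟶ G) (s : P.obj (op G)) :
    evalHom P F (P.map f.op s) = ((fpYoneda A).obj (selfValue P)).map f.op (evalHom P G s) := by
  refine ModuleCat.hom_ext (LinearMap.ext fun x => ?_)
  change P.map (F.point x).op (P.map f.op s) = P.map (G.point (f.hom.hom x)).op s
  rw [← FPMod.point_comp]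
  exact (ConcreteCategory.congr_hom (P.map_comp _ _) s).symm

/-- The inverse is evaluation at `1`, as for any `Hom_A(A, -)`. -/
theorem bijective_evalHom_self : Function.Bijective (evalHom P (FPMod.self A)) := by
  constructor
  · intro s t hst
    have h1 := congrArg (fun k : ModuleCat.of A A ⟶ selfValue P => k.hom (1 : A)) hst
    exact (one_smul A (show SelfValue P from s)).symm.trans (h1.trans (one_smul A _))
  · intro f
    exact ⟨ModuleCat.Hom.hom (show ModuleCat.of A A ⟶ selfValue P from f) (1 : A),
      (eq_pointHom (show ModuleCat.of A A ⟶ selfValue P from f)).symm⟩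

/-- A flat contravariant functor on finitely presented modules is represented by its value at the
ring. -/
def evalIso (hP : IsFlat P) : P ≅ (fpYoneda A).obj (selfValue P) :=
  -- `P` and `Hom(-, P(A))` are both flat, hence both left exact, so it suffices to compare them at
  -- the ring.
  haveI h := hP.isLeftExact.bijective_of_bijective_self (isFlat_fpYoneda _).isLeftExact
    (evalHom P) (evalHom_naturality P) (bijective_evalHom_self P)
  NatIso.ofComponents
    (fun F => (AddEquiv.ofBijective (evalHom P F.unop) (h F.unop)).toAddCommGrpIso)
    fun f => by
      ext x
      exact evalHom_naturality P f.unop x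

/-- Naturality along `A ⟶ F`, `a ↦ a x`, shows that `τ` is determined by its component at the ring.
This gives both the linearity of the preimage and the fact that it induces `τ`. -/
theorem fpYoneda_hom_apply {M M' : ModuleCat.{u} A} (τ : (fpYoneda A).obj M ⟶ (fpYoneda A).obj M')
    {F : FPMod A} (f : F.obj ⟶ M) (x : F.obj) :
    ModuleCat.Hom.hom (show F.obj ⟶ M' from τ.app (op F) f) x =
      ModuleCat.Hom.hom (show ModuleCat.of A A ⟶ M' from
        τ.app (op (FPMod.self A)) (pointHom M (f.hom x))) (1 : A) := by
  rw [← pointHom_comp]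
  refine Eq.trans ?_ (congrArg (fun k : ModuleCat.of A A ⟶ M' => k.hom (1 : A))
    (NatTrans.naturality_apply τ (F.point x).op f)).symm
  change _ = ModuleCat.Hom.hom (show F.obj ⟶ M' from τ.app (op F) f) ((1 : A) • x)
  rw [one_smul]

/-- The linear map inducing a natural transformation `Hom(-, M) ⟶ Hom(-, M')`. -/
def fpYonedaPreimage {M M' : ModuleCat.{u} A} (τ : (fpYoneda A).obj M ⟶ (fpYoneda A).obj M') :
    M ⟶ M' :=
  ModuleCat.ofHom
    { toFun := fun m => ModuleCat.Hom.hom (show ModuleCat.of A A ⟶ M' from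
        τ.app (op (FPMod.self A)) (pointHom M m)) (1 : A)
      map_add' := fun m m' => by
        rw [pointHom_add]
        exact congrArg (fun k : ModuleCat.of A A ⟶ M' => k.hom (1 : A))
          (map_add (τ.app (op (FPMod.self A))).hom (pointHom M m) (pointHom M m'))
      map_smul' := fun a m => by
        have h := fpYoneda_hom_apply τ (F := FPMod.self A) (pointHom M m) a
        have h' : (pointHom M m).hom a = a • m := rfl
        rw [h'] at h
        refine h.symm.trans ?_
        rw [← map_smul, smul_eq_mul, RingHom.id_apply, mul_one] }

theorem fpYoneda_map_preimage {M M' : ModuleCat.{u} A}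
    (τ : (fpYoneda A).obj M ⟶ (fpYoneda A).obj M') :
    (fpYoneda A).map (fpYonedaPreimage τ) = τ := by
  ext F f
  refine ModuleCat.hom_ext (LinearMap.ext fun x => ?_)
  exact (fpYoneda_hom_apply τ (F := F.unop) f x).symm

theorem fpYoneda_map_apply {M M' : ModuleCat.{u} A} (f : M ⟶ M') (m : M) :
    ((fpYoneda A).map f).app (op (FPMod.self A)) (pointHom M m) = pointHom M' (f.hom m) :=
  pointHom_comp m f

instance : (fpYoneda A).Faithful where
  map_injective {M M' f g} h := by
    ext m
    have h' := congrArg (fun τ => τ.app (op (FPMod.self A)) (pointHom M m)) h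
    rw [fpYoneda_map_apply, fpYoneda_map_apply] at h'
    have h₁ := congrArg (fun k : ModuleCat.of A A ⟶ M' => k.hom (1 : A)) h'
    exact (one_smul A _).symm.trans (h₁.trans (one_smul A _))

end Representable

/-! ### Morphisms out of an extension of scalars -/

section AdjointHom

variable {A B : Type w} [Category.{v} A] [Category.{v} B] [Preadditive B]
  {M M' : Aᵒᵖ ⥤ AddCommGrpCat.{v}} {N N' : Bᵒᵖ ⥤ AddCommGrpCat.{v}} [N.Additive] [N'.Additive]

/-- The universe lift in the target of `adjointHom` is a bijection, so it can be dropped. -/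
theorem isIso_adjointHom_iff_bijective (φ : A ⥤ B) (F : M ⟶ φ.op ⋙ N) :
    IsIso (adjointHom φ F) ↔ ∀ s, Function.Bijective (adjointApp φ F s) := by
  rw [NatTrans.isIso_iff_isIso_app]
  refine ⟨fun h s => ?_, fun h s => ?_⟩
  · have hs := (ConcreteCategory.isIso_iff_bijective _).1 (h (op s))
    exact (Equiv.ulift.symm.bijective.of_comp_iff' _).1 hs
  · exact (ConcreteCategory.isIso_iff_bijective _).2
      ((Equiv.ulift.symm.bijective.of_comp_iff' _).2 (h s.unop))

/-- Functoriality of `M ⊗_A L` in the right module `M`. -/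
def Tensor.mapLeft (τ : M ⟶ M') (L : A ⥤ AddCommGrpCat.{v}) : Tensor M L →+ Tensor M' L :=
  Tensor.lift
    (fun a => AddMonoidHom.mk' (fun x => AddMonoidHom.mk'
        (fun y => Tensor.tmul a (τ.app (op a) x) y) fun y y' => Tensor.tmul_add _ _ _ _)
      fun x x' => by ext y; simp [Tensor.add_tmul])
    fun a b r x y => by
      simp only [AddMonoidHom.mk'_apply]
      rw [NatTrans.naturality_apply, Tensor.tmul_rel]

theorem Tensor.mapLeft_tmul (τ : M ⟶ M') (L : A ⥤ AddCommGrpCat.{v}) (a : A) (x : M.obj (op a))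
    (y : L.obj a) :
    Tensor.mapLeft τ L (Tensor.tmul a x y) = Tensor.tmul a (τ.app (op a) x) y :=
  Tensor.lift_tmul _ _ _ _ _

theorem Tensor.bijective_mapLeft (i : M ≅ M') (L : A ⥤ AddCommGrpCat.{v}) :
    Function.Bijective (Tensor.mapLeft i.hom L) := by
  have h₁ : (Tensor.mapLeft i.inv L).comp (Tensor.mapLeft i.hom L) = AddMonoidHom.id _ :=
    Tensor.hom_ext fun a x y => by simp [Tensor.mapLeft_tmul]
  have h₂ : (Tensor.mapLeft i.hom L).comp (Tensor.mapLeft i.inv L) = AddMonoidHom.id _ :=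
    Tensor.hom_ext fun a x y => by simp [Tensor.mapLeft_tmul]
  exact Function.bijective_iff_has_inverse.2
    ⟨Tensor.mapLeft i.inv L, DFunLike.congr_fun h₁, DFunLike.congr_fun h₂⟩

/-- Invariance under isomorphism of the condition that `φ_! M ⟶ N` is an isomorphism. -/
theorem isIso_adjointHom_of_iso (φ : A ⥤ B) (F : M ⟶ φ.op ⋙ N) (F' : M' ⟶ φ.op ⋙ N') (i : M ≅ M')
    (j : N ≅ N') (h : F ≫ Functor.whiskerLeft φ.op j.hom = i.hom ≫ F')
    (hF : IsIso (adjointHom φ F)) :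
    IsIso (adjointHom φ F') := by
  rw [isIso_adjointHom_iff_bijective] at hF ⊢
  intro s
  have hj : Function.Bijective (j.hom.app (op s)) :=
    (ConcreteCategory.isIso_iff_bijective _).1 inferInstance
  have hs : (adjointApp φ F' s).comp (Tensor.mapLeft i.hom _) =
      (j.hom.app (op s)).hom.comp (adjointApp φ F s) := by
    refine Tensor.hom_ext fun a x y => ?_
    rw [AddMonoidHom.comp_apply, AddMonoidHom.comp_apply, Tensor.mapLeft_tmul]
    refine (adjointApp_tmul φ F' s a _ y).trans ?_
    refine Eq.trans ?_ (congrArg (j.hom.app (op s)).hom (adjointApp_tmul φ F s a x y)).symm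
    have h₁ := congrArg (fun k => AddCommGrpCat.Hom.hom (NatTrans.app k (op a)) x) h
    refine (congrArg (N'.map (Quiver.Hom.op y)) h₁.symm).trans ?_
    exact (NatTrans.naturality_apply j.hom (Quiver.Hom.op y) _).symm
  refine (Function.Bijective.of_comp_iff _
    (Tensor.bijective_mapLeft i (homModule φ s))).1 ?_
  rw [← AddMonoidHom.coe_comp, hs, AddMonoidHom.coe_comp]
  exact hj.comp (hF s)

end AdjointHom

/-! ### Extension of scalars of representable modules -/

section Extension

variable {A B : Type u} [Ring A] [Ring B] (φ : A →+* B)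

variable {φ} in
theorem BaseChange.induction_on {M : Type u} [AddCommGroup M] [Module A M]
    {p : BaseChange φ M → Prop} (z : BaseChange φ M) (zero : p 0)
    (tmul : ∀ b m, p (BaseChange.tmul φ b m)) (add : ∀ s t, p s → p t → p (s + t)) : p z := by
  obtain ⟨z, rfl⟩ := Submodule.mkQ_surjective _ z
  induction z using TensorProduct.induction_on with
  | zero => rw [map_zero]; exact zero
  | tmul b m => exact tmul b m
  | add s t hs ht => rw [map_add]; exact add _ _ hs ht

/-- The element of `φ_! F` given by a morphism `B ⟶ φ_! F`. -/
abbrev extendEval {F : FPMod A} (h : FPMod.self B ⟶ (fpExtend φ).obj F) : BaseChange φ F.obj :=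
  h.hom.hom (1 : B)

/-- The morphism `B ⟶ φ_! F` given by an element of `φ_! F`. -/
abbrev extendPoint {F : FPMod A} (z : BaseChange φ F.obj) : FPMod.self B ⟶ (fpExtend φ).obj F :=
  FPMod.point ((fpExtend φ).obj F) z

theorem extendPoint_eval {F : FPMod A} (h : FPMod.self B ⟶ (fpExtend φ).obj F) :
    extendPoint φ (extendEval φ h) = h :=
  (isFP B).hom_ext (eq_pointHom h.hom).symm

theorem extendEval_point {F : FPMod A} (z : BaseChange φ F.obj) :
    extendEval φ (extendPoint φ z) = z :=
  one_smul B z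

theorem extendPoint_add {F : FPMod A} (z z' : BaseChange φ F.obj) :
    extendPoint φ (z + z') = extendPoint φ z + extendPoint φ z' :=
  FPMod.point_add ((fpExtend φ).obj F) z z'

theorem extendPoint_map {F G : FPMod A} (g : F ⟶ G) (z : BaseChange φ F.obj) :
    extendPoint φ z ≫ (fpExtend φ).map g = extendPoint φ (BaseChange.map φ g.hom.hom z) :=
  FPMod.point_comp (F := (fpExtend φ).obj F) z ((fpExtend φ).map g)

variable (M : ModuleCat.{u} A)

/-- The pairing `(f, h) ↦ (φ_! f)(h(1))`. -/
def baseChangePairing (F : FPMod A) : ((fpYoneda A).obj M).obj (op F) →+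
    (homModule (fpExtend φ) (FPMod.self B)).obj F →+ BaseChange φ M :=
  AddMonoidHom.mk' (fun f : F.obj ⟶ M => AddMonoidHom.mk'
      (fun h : FPMod.self B ⟶ (fpExtend φ).obj F => BaseChange.map φ f.hom (extendEval φ h))
      fun h h' => map_add (BaseChange.map φ f.hom) (extendEval φ h) (extendEval φ h'))
    fun f f' => AddMonoidHom.ext fun h => by
      have h' := (extendScalars φ).map_add (f := f) (g := f')
      exact congrArg (fun k => ModuleCat.Hom.hom k
        (extendEval φ (show FPMod.self B ⟶ (fpExtend φ).obj F from h))) h'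

theorem baseChangePairing_balanced (F G : FPMod A) (r : F ⟶ G)
    (f : ((fpYoneda A).obj M).obj (op G)) (h : (homModule (fpExtend φ) (FPMod.self B)).obj F) :
    baseChangePairing φ M F (((fpYoneda A).obj M).map r.op f) h =
      baseChangePairing φ M G f ((homModule (fpExtend φ) (FPMod.self B)).map r h) := by
  have h' := (extendScalars φ).map_comp r.hom (show G.obj ⟶ M from f)
  exact congrArg (fun k => ModuleCat.Hom.hom k
    (extendEval φ (show FPMod.self B ⟶ (fpExtend φ).obj F from h))) h'

/-- The homomorphism `Hom_A(-, M) ⊗ Hom_B(B, φ_!(-)) → φ_! M`, `f ⊗ h ↦ (φ_! f)(h(1))`. -/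
def tensorToBaseChange :
    Tensor ((fpYoneda A).obj M) (homModule (fpExtend φ) (FPMod.self B)) →+ BaseChange φ M :=
  Tensor.lift (baseChangePairing φ M) (baseChangePairing_balanced φ M)

theorem tensorToBaseChange_tmul {F : FPMod A} (f : F.obj ⟶ M)
    (h : FPMod.self B ⟶ (fpExtend φ).obj F) :
    tensorToBaseChange φ M (homTmul (N := homModule (fpExtend φ) (FPMod.self B)) f h) =
      BaseChange.map φ f.hom (extendEval φ h) :=
  Tensor.lift_tmul (baseChangePairing φ M) (baseChangePairing_balanced φ M) F f h

variable {M}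

/-- The element `f ⊗ h` for the morphism `h : B ⟶ φ_! F` given by `z`. -/
def homTmulPoint {F : FPMod A} (f : F.obj ⟶ M) (z : BaseChange φ F.obj) :
    Tensor ((fpYoneda A).obj M) (homModule (fpExtend φ) (FPMod.self B)) :=
  homTmul (N := homModule (fpExtend φ) (FPMod.self B)) f (extendPoint φ z)

theorem homTmulPoint_add {F : FPMod A} (f : F.obj ⟶ M) (z z' : BaseChange φ F.obj) :
    homTmulPoint φ f (z + z') = homTmulPoint φ f z + homTmulPoint φ f z' := by
  rw [homTmulPoint, extendPoint_add]
  exact homTmul_add (N := homModule (fpExtend φ) (FPMod.self B)) f _ _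

theorem homTmulPoint_add_left {F : FPMod A} (f f' : F.obj ⟶ M) (z : BaseChange φ F.obj) :
    homTmulPoint φ (f + f') z = homTmulPoint φ f z + homTmulPoint φ f' z :=
  Tensor.add_tmul (M := (fpYoneda A).obj M) F f f' _

theorem homTmulPoint_comp {F G : FPMod A} (g : F ⟶ G) (f : G.obj ⟶ M) (z : BaseChange φ F.obj) :
    homTmulPoint φ (g.hom ≫ f) z = homTmulPoint φ f (BaseChange.map φ g.hom.hom z) := by
  refine (homTmul_comp (N := homModule (fpExtend φ) (FPMod.self B)) g f _).trans ?_
  exact congrArg (homTmul (N := homModule (fpExtend φ) (FPMod.self B)) f) (extendPoint_map φ g z)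

/-- Balancing along `A ⟶ F`, `a ↦ a x`, moves every generator to the ring, where the inverse of
`tensorToBaseChange` is defined. -/
theorem homTmulPoint_pointHom {F : FPMod A} (f : F.obj ⟶ M) (b : B) (x : F.obj) :
    homTmulPoint φ (F := FPMod.self A) (pointHom M (f.hom x)) (BaseChange.tmul φ b (1 : A)) =
      homTmulPoint φ f (BaseChange.tmul φ b x) := by
  rw [← pointHom_comp]
  refine (homTmulPoint_comp φ (F.point x) f _).trans ?_
  rw [BaseChange.map_tmul]
  exact congrArg (fun y => homTmulPoint φ f (BaseChange.tmul φ b y)) (one_smul A x)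

variable (M)

/-- The homomorphism `B ⊗_ℤ M → Hom_A(-, M) ⊗ Hom_B(B, φ_!(-))` that sends `b ⊗ m` to `f ⊗ h`, with
`f : A ⟶ M` and `h : B ⟶ φ_! A` given by `m` and `b ⊗ 1`. -/
def preBaseChangeToTensor :
    B ⊗[ℤ] M →+ Tensor ((fpYoneda A).obj M) (homModule (fpExtend φ) (FPMod.self B)) :=
  TensorProduct.liftAddHom
    (AddMonoidHom.mk' (fun b => AddMonoidHom.mk'
        (fun m => homTmulPoint φ (F := FPMod.self A) (pointHom M m) (BaseChange.tmul φ b (1 : A)))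
        fun m m' => by rw [pointHom_add, homTmulPoint_add_left])
      fun b b' => AddMonoidHom.ext fun m => by
        refine (congrArg (homTmulPoint φ (F := FPMod.self A) (pointHom M m))
          (BaseChange.add_tmul φ b b' (1 : A))).trans ?_
        exact homTmulPoint_add φ _ _ _)
    fun n b m => by rw [map_zsmul, map_zsmul]; rfl

theorem preBaseChangeToTensor_tmul (b : B) (m : M) :
    preBaseChangeToTensor φ M (b ⊗ₜ m) =
      homTmulPoint φ (F := FPMod.self A) (pointHom M m) (BaseChange.tmul φ b (1 : A)) :=
  TensorProduct.liftAddHom_tmul _ _ _ _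

theorem preBaseChangeToTensor_rel (b : B) (a : A) (m : M) :
    preBaseChangeToTensor φ M ((b * φ a) ⊗ₜ m) = preBaseChangeToTensor φ M (b ⊗ₜ (a • m)) := by
  rw [preBaseChangeToTensor_tmul, preBaseChangeToTensor_tmul]
  refine Eq.trans ?_ (homTmulPoint_pointHom φ (F := FPMod.self A) (pointHom M m) b a).symm
  refine congrArg (homTmulPoint φ (F := FPMod.self A) (pointHom M m)) ?_
  rw [BaseChange.mul_tmul, smul_eq_mul, mul_one]

theorem preBaseChangeToTensor_eq_zero (t : B ⊗[ℤ] M) (ht : t ∈ baseChangeRel φ M) :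
    preBaseChangeToTensor φ M t = 0 := by
  -- The relations are a `B`-span while the map is only additive, so the claim is strengthened to
  -- all multiples `b • t` to survive the scalar step of the induction.
  suffices h : ∀ b : B, preBaseChangeToTensor φ M (b • t) = 0 by
    rw [← one_smul B t]
    exact h 1
  induction ht using Submodule.span_induction with
  | mem t ht =>
    obtain ⟨b', a, m, rfl⟩ := ht
    intro b
    rw [smul_sub, TensorProduct.smul_tmul', TensorProduct.smul_tmul', map_sub, smul_eq_mul,
      smul_eq_mul, ← mul_assoc, preBaseChangeToTensor_rel, sub_self]
  | zero => intro b; rw [smul_zero, map_zero]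
  | add s t _ _ hs ht => intro b; rw [smul_add, map_add, hs, ht, add_zero]
  | smul c t _ ht => intro b; rw [smul_smul, ht]

/-- The homomorphism `φ_! M → Hom_A(-, M) ⊗ Hom_B(B, φ_!(-))`. -/
def baseChangeToTensor :
    BaseChange φ M →+ Tensor ((fpYoneda A).obj M) (homModule (fpExtend φ) (FPMod.self B)) :=
  QuotientAddGroup.lift (baseChangeRel φ M).toAddSubgroup (preBaseChangeToTensor φ M)
    (preBaseChangeToTensor_eq_zero φ M)

theorem baseChangeToTensor_tmul (b : B) (m : M) :
    baseChangeToTensor φ M (BaseChange.tmul φ b m) =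
      homTmulPoint φ (F := FPMod.self A) (pointHom M m) (BaseChange.tmul φ b (1 : A)) :=
  preBaseChangeToTensor_tmul φ M b m

theorem baseChangeToTensor_map {F : FPMod A} (f : F.obj ⟶ M) (z : BaseChange φ F.obj) :
    baseChangeToTensor φ M (BaseChange.map φ f.hom z) = homTmulPoint φ f z := by
  let l : BaseChange φ F.obj →+
      Tensor ((fpYoneda A).obj M) (homModule (fpExtend φ) (FPMod.self B)) :=
    AddMonoidHom.mk' (homTmulPoint φ f) (homTmulPoint_add φ f)
  change _ = l z
  induction z using BaseChange.induction_on with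
  | zero => simp only [map_zero]
  | tmul b x =>
    rw [BaseChange.map_tmul, baseChangeToTensor_tmul]
    exact homTmulPoint_pointHom φ f b x
  | add s t hs ht => rw [map_add, map_add, map_add, hs, ht]

/-- The isomorphism `Hom_A(-, M) ⊗ Hom_B(B, φ_!(-)) ≅ φ_! M`. -/
theorem bijective_tensorToBaseChange : Function.Bijective (tensorToBaseChange φ M) := by
  refine Function.bijective_iff_has_inverse.2 ⟨baseChangeToTensor φ M, fun t => ?_, fun z => ?_⟩
  · obtain ⟨F, f, h, rfl⟩ := exists_eq_homTmul t
    refine (congrArg _ (tensorToBaseChange_tmul φ M f h)).trans ?_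
    rw [baseChangeToTensor_map]
    exact congrArg (homTmul (N := homModule (fpExtend φ) (FPMod.self B)) f) (extendPoint_eval φ h)
  · induction z using BaseChange.induction_on with
    | zero => rw [map_zero, map_zero]
    | tmul b m =>
      rw [baseChangeToTensor_tmul]
      refine (tensorToBaseChange_tmul φ M (F := FPMod.self A) (pointHom M m) _).trans ?_
      rw [extendEval_point]
      refine (BaseChange.map_tmul φ (pointHom M m).hom b (1 : A)).trans ?_
      exact congrArg _ (one_smul A m)
    | add s t hs ht => rw [map_add, map_add, hs, ht]

variable {φ M} {N : ModuleCat.{u} B} (g : M ⟶ (ModuleCat.restrictScalars φ).obj N)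

/-- The morphism `Hom_A(-, M) ⟶ Hom_B(φ_!(-), N)` induced by `g : M ⟶ φ^* N`. -/
abbrev yonedaSemi : (fpYoneda A).obj M ⟶ (fpExtend φ).op ⋙ (fpYoneda B).obj N :=
  (fpYoneda A).map g ≫ fpYonedaAdj φ N

/-- Under `Hom(B, N) ≅ N` and `tensorToBaseChange`, the component at the ring becomes the adjoint
`φ_! M ⟶ N` of `g`. On `f ⊗ h` this is naturality of the adjunction in the first variable. -/
theorem adjointApp_self_eval
    (t : Tensor ((fpYoneda A).obj M) (homModule (fpExtend φ) (FPMod.self B))) :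
    ModuleCat.Hom.hom (show ModuleCat.of B B ⟶ N from
        adjointApp (fpExtend φ) (yonedaSemi g) (FPMod.self B) t) (1 : B) =
      (((extendRestrictAdj φ).homEquiv M N).symm g).hom (tensorToBaseChange φ M t) := by
  obtain ⟨F, f, h, rfl⟩ := exists_eq_homTmul t
  refine Eq.trans ?_ (congrArg _ (tensorToBaseChange_tmul φ M f h).symm)
  refine (congrArg (fun k : ModuleCat.of B B ⟶ N => k.hom (1 : B)) (adjointApp_tmul
    (M := (fpYoneda A).obj M) (fpExtend φ) (yonedaSemi g) (FPMod.self B) F f h)).trans ?_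
  exact congrArg (fun k => ModuleCat.Hom.hom k (extendEval φ h))
    ((extendRestrictAdj φ).homEquiv_naturality_left_symm f g)

theorem bijective_adjointApp_self_iff :
    Function.Bijective (adjointApp (fpExtend φ) (yonedaSemi g) (FPMod.self B)) ↔
      Function.Bijective (((extendRestrictAdj φ).homEquiv M N).symm g).hom := by
  let ev : (ModuleCat.of B B ⟶ N) → N := fun k => k.hom (1 : B)
  have hev : Function.Bijective ev := Function.bijective_iff_has_inverse.2
    ⟨pointHom N, fun k => (eq_pointHom k).symm, fun y => one_smul B y⟩
  refine (hev.of_comp_iff' _).symm.trans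
    (Iff.trans ?_ (Function.Bijective.of_comp_iff _ (bijective_tensorToBaseChange φ M)))
  exact Iff.of_eq (congrArg _ (funext (adjointApp_self_eval g)))

/-- Source and target are left exact, the source because `Hom(-, M)` is flat, so invertibility can
be tested at the ring `B`. -/
theorem isIso_adjointHom_yonedaSemi_iff :
    IsIso (adjointHom (fpExtend φ) (yonedaSemi g)) ↔
      IsIso (((extendRestrictAdj φ).homEquiv M N).symm g) := by
  rw [isIso_adjointHom_iff_bijective, ConcreteCategory.isIso_iff_bijective]
  refine Iff.trans ⟨fun h => h (FPMod.self B), fun h => ?_⟩ (bijective_adjointApp_self_iff g)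
  exact ((isFlat_fpYoneda M).isLeftExact_extendModule (fpExtend φ)).bijective_of_bijective_self
    (isFlat_fpYoneda N).isLeftExact (adjointApp (fpExtend φ) (yonedaSemi g))
    (adjointApp_naturality _ _) h

theorem fpYonedaAdj_naturality {N' : ModuleCat.{u} B} (k : N ⟶ N') :
    (fpYoneda A).map ((ModuleCat.restrictScalars φ).map k) ≫ fpYonedaAdj φ N' =
      fpYonedaAdj φ N ≫ Functor.whiskerLeft (fpExtend φ).op ((fpYoneda B).map k) := by
  ext F f
  exact (extendRestrictAdj φ).homEquiv_naturality_right_symm f k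

instance : IsIso (fpYonedaAdj φ N) := by
  rw [NatTrans.isIso_iff_isIso_app]
  exact fun F => (ConcreteCategory.isIso_iff_bijective _).2
    ((extendRestrictAdj φ).homEquiv F.unop.obj N).symm.bijective

theorem yonedaSemi_tmul {F : FPMod A} (f : F.obj ⟶ M) (b : B) (x : F.obj) :
    ModuleCat.Hom.hom (show (extendScalars φ).obj F.obj ⟶ N from
      (yonedaSemi g).app (op F) f) (BaseChange.tmul φ b x) = b • toSemilinear φ g (f.hom x) :=
  extendRestrictAdj_symm_tmul φ (f ≫ g) b x

end Extension

/-! ### Transport of structural morphisms -/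

section Transport

variable {A B D : Type u} [Ring A] [Ring B] [Ring D] {φ : A →+* B} {ψ : B →+* D} {χ : A →+* D}
  {P : (FPMod A)ᵒᵖ ⥤ AddCommGrpCat.{u}} {Q : (FPMod B)ᵒᵖ ⥤ AddCommGrpCat.{u}}
  {S : (FPMod D)ᵒᵖ ⥤ AddCommGrpCat.{u}}
  {M : ModuleCat.{u} A} {N : ModuleCat.{u} B} {L : ModuleCat.{u} D}

/-- The morphism `M ⟶ φ^* N` corresponding to a morphism `P ⟶ φ^* Q`, for `P ≅ Hom(-, M)` and
`Q ≅ Hom(-, N)`. -/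
def semiOf (e : P ≅ (fpYoneda A).obj M) (e' : Q ≅ (fpYoneda B).obj N)
    (T : P ⟶ (fpExtend φ).op ⋙ Q) : M ⟶ (ModuleCat.restrictScalars φ).obj N :=
  fpYonedaPreimage (e.inv ≫ T ≫ Functor.whiskerLeft (fpExtend φ).op e'.hom ≫
    inv (fpYonedaAdj φ N))

variable (e : P ≅ (fpYoneda A).obj M) (e' : Q ≅ (fpYoneda B).obj N)
  (e'' : S ≅ (fpYoneda D).obj L)

theorem semiOf_comm (T : P ⟶ (fpExtend φ).op ⋙ Q) :
    T ≫ Functor.whiskerLeft (fpExtend φ).op e'.hom = e.hom ≫ yonedaSemi (semiOf e e' T) := by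
  rw [yonedaSemi, semiOf, fpYoneda_map_preimage]
  simp only [Category.assoc, IsIso.inv_hom_id, Category.comp_id, Iso.hom_inv_id_assoc]

theorem semiOf_comm_inv (T : P ⟶ (fpExtend φ).op ⋙ Q) :
    yonedaSemi (semiOf e e' T) ≫ Functor.whiskerLeft (fpExtend φ).op e'.inv = e.inv ≫ T := by
  rw [Iso.eq_inv_comp, ← Category.assoc, ← semiOf_comm, Category.assoc,
    ← Functor.whiskerLeft_comp, Iso.hom_inv_id, Functor.whiskerLeft_id']
  exact Category.comp_id _

theorem semiOf_tmul (T : P ⟶ (fpExtend φ).op ⋙ Q) {F : FPMod A} (s : P.obj (op F)) (b : B)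
    (x : F.obj) :
    ModuleCat.Hom.hom (show (extendScalars φ).obj F.obj ⟶ N from
        e'.hom.app (op ((fpExtend φ).obj F)) (T.app (op F) s)) (BaseChange.tmul φ b x) =
      b • toSemilinear φ (semiOf e e' T)
        (ModuleCat.Hom.hom (show F.obj ⟶ M from e.hom.app (op F) s) x) := by
  have h := congrArg (fun k => AddCommGrpCat.Hom.hom (NatTrans.app k (op F)) s)
    (semiOf_comm e e' T)
  refine (congrArg (fun k : (extendScalars φ).obj F.obj ⟶ N => k.hom (BaseChange.tmul φ b x))
    h).trans ?_
  exact yonedaSemi_tmul (semiOf e e' T) (e.hom.app (op F) s) b x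

theorem exists_app_eq_pointHom (m : M) :
    ∃ s : P.obj (op (FPMod.self A)), e.hom.app (op (FPMod.self A)) s = pointHom M m :=
  ((ConcreteCategory.isIso_iff_bijective (e.hom.app (op (FPMod.self A)))).1 inferInstance).2
    (pointHom M m)

/-- This computes the transported map on elements: lift `m` to `s` in `P(A)`, apply `T`, and
evaluate at `1 ⊗ 1`. Laws for `T` thereby become laws for `semiOf`. -/
theorem semiOf_tmul_point (T : P ⟶ (fpExtend φ).op ⋙ Q) {s : P.obj (op (FPMod.self A))} {m : M}
    (hs : e.hom.app (op (FPMod.self A)) s = pointHom M m) :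
    ModuleCat.Hom.hom (show (extendScalars φ).obj (FPMod.self A).obj ⟶ N from
        e'.hom.app (op ((fpExtend φ).obj (FPMod.self A))) (T.app (op (FPMod.self A)) s))
        (BaseChange.tmul φ 1 (1 : A)) =
      toSemilinear φ (semiOf e e' T) m := by
  refine (semiOf_tmul e e' T s 1 (1 : A)).trans ?_
  rw [hs, one_smul]
  exact congrArg _ (one_smul A m)

theorem semiOf_id {φ : A →+* A} (h : φ = RingHom.id A) (T : P ⟶ (fpExtend φ).op ⋙ P)
    (hT : ∀ F s, P.map ((fpExtendId h).hom.app F).op (T.app (op F) s) = s) (m : M) :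
    toSemilinear φ (semiOf e e T) m = m := by
  obtain ⟨s, hs⟩ := exists_app_eq_pointHom e m
  rw [← semiOf_tmul_point e e T hs]
  have h₁ := NatTrans.naturality_apply e.hom ((fpExtendId h).hom.app (FPMod.self A)).op
    (T.app (op (FPMod.self A)) s)
  rw [hT] at h₁
  exact (congrArg (fun k : ModuleCat.of A A ⟶ M => k.hom (1 : A))
    (hs.symm.trans h₁)).symm.trans (one_smul A m)

/-- Both sides are values at the generator: the coherence isomorphism sends `1 ⊗ (1 ⊗ 1)` to `1 ⊗
1`, and naturality of `e''` along it carries the composition law over. -/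
theorem semiOf_comp (h : ψ.comp φ = χ) (T : P ⟶ (fpExtend φ).op ⋙ Q)
    (U : Q ⟶ (fpExtend ψ).op ⋙ S) (V : P ⟶ (fpExtend χ).op ⋙ S)
    (hV : ∀ F s, S.map ((fpExtendComp h).hom.app F).op (V.app (op F) s) =
      U.app (op ((fpExtend φ).obj F)) (T.app (op F) s)) (m : M) :
    toSemilinear χ (semiOf e e'' V) m =
      toSemilinear ψ (semiOf e' e'' U) (toSemilinear φ (semiOf e e' T) m) := by
  obtain ⟨s, hs⟩ := exists_app_eq_pointHom e m
  rw [← semiOf_tmul_point e e' T hs, ← semiOf_tmul_point e e'' V hs]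
  refine Eq.trans ?_ ((semiOf_tmul e' e'' U (T.app (op (FPMod.self A)) s) 1
    (BaseChange.tmul φ 1 (1 : A))).trans (one_smul D _))
  have h₁ := NatTrans.naturality_apply e''.hom ((fpExtendComp h).hom.app (FPMod.self A)).op
    (V.app (op (FPMod.self A)) s)
  rw [hV] at h₁
  refine Eq.trans ?_ (congrArg
    (fun k : (extendScalars ψ).obj ((extendScalars φ).obj (FPMod.self A).obj) ⟶ L =>
      k.hom (BaseChange.tmul ψ 1 (BaseChange.tmul φ 1 (1 : A)))) h₁).symm
  refine congrArg (ModuleCat.Hom.hom (show (extendScalars χ).obj (FPMod.self A).obj ⟶ L from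
    e''.hom.app (op ((fpExtend χ).obj (FPMod.self A))) (V.app (op (FPMod.self A)) s))) ?_
  refine Eq.symm ((BaseChange.compEquiv_tmul h 1 1 (1 : A)).trans ?_)
  rw [map_one, mul_one]

end Transport

/-! ### The levelwise Yoneda functor -/

section Levelwise

variable {C : Type u₁} [Category.{v₁} C] {R : C ⥤ RingCat.{u}}

instance : (yonedaFP R).Faithful where
  map_injective {M N f g} h := by
    refine RingMod.Hom.ext (funext fun c => (fpYoneda (R.obj c)ᵐᵒᵖ).map_injective ?_)
    exact congrFun (congrArg AddRep.RightMod.Hom.app h) c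

instance : (yonedaFP R).Full where
  map_surjective {M N} τ := by
    let φ (c : C) : M.obj c ⟶ N.obj c := fpYonedaPreimage (τ.app c)
    have hφ (c : C) : (fpYoneda (R.obj c)ᵐᵒᵖ).map (φ c) = τ.app c := fpYoneda_map_preimage _
    refine ⟨{ app := φ, comm := fun {c d} α => ?_ },
      AddRep.RightMod.Hom.ext (funext hφ)⟩
    -- Compatibility may be tested after Yoneda and after composition with the isomorphism `Hom(-,
    -- α^* N_d) ≅ Hom(α_!(-), N_d)`, where it is the compatibility of `τ`.
    apply (fpYoneda (R.obj c)ᵐᵒᵖ).map_injective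
    rw [← cancel_mono (fpYonedaAdj (opMap R α) (N.obj d)), Functor.map_comp, Functor.map_comp,
      Category.assoc, Category.assoc, fpYonedaAdj_naturality, hφ, hφ, ← Category.assoc]
    exact τ.comm α

/-! ### Levelwise representable modules come from modules over `R`. -/

section EssSurj

variable (P : (fpRep R).RightMod) {M : ∀ c, ModuleCat.{u} (R.obj c)ᵐᵒᵖ}
  (e : ∀ c, P.obj c ≅ (fpYoneda (R.obj c)ᵐᵒᵖ).obj (M c))

/-- The module over `R` with the modules `M_c` for a right module `P` with `P_c ≅ Hom(-, M_c)`. -/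
def transportMod : RingMod R where
  obj := M
  map {c d} α := semiOf (e c) (e d) (P.map α)
  map_comp {c d f} α β := semiOf_comp (e c) (e d) (e f) (opMap_comp R rfl) (P.map α) (P.map β)
    (P.map (α ≫ β)) fun F s => ConcreteCategory.congr_hom (P.map_comp rfl F) s
  map_id c := semiOf_id (e c) (opMap_id R c) (P.map (𝟙 c))
    fun F s => ConcreteCategory.congr_hom (P.map_id c F) s

/-- A right module that is levelwise representable comes from a module over `R`. -/
def transportIso : P ≅ (yonedaFP R).obj (transportMod P e) where
  hom :=
    { app := fun c => (e c).hom
      comm := fun {c d} α => semiOf_comm (e c) (e d) (P.map α) }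
  inv :=
    { app := fun c => (e c).inv
      comm := fun {c d} α => semiOf_comm_inv (e c) (e d) (P.map α) }
  hom_inv_id := AddRep.RightMod.Hom.ext (funext fun c => (e c).hom_inv_id)
  inv_hom_id := AddRep.RightMod.Hom.ext (funext fun c => (e c).inv_hom_id)

end EssSurj

theorem isLocallyFlat_yonedaFP (M : RingMod R) :
    AddRep.RightMod.IsLocallyFlat (fpRep R) ((yonedaFP R).obj M) :=
  fun c => isFlat_fpYoneda (M.obj c)

/-- A locally flat right module is levelwise representable. -/
theorem exists_iso_yonedaFP (P : (fpRep R).RightMod)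
    (hP : AddRep.RightMod.IsLocallyFlat (fpRep R) P) :
    ∃ M : RingMod R, Nonempty ((yonedaFP R).obj M ≅ P) :=
  let Q (c : C) : (FPMod (R.obj c)ᵐᵒᵖ)ᵒᵖ ⥤ AddCommGrpCat.{u} := P.obj c
  haveI (c : C) : (Q c).Additive := P.additive c
  ⟨_, ⟨(transportIso P fun c => evalIso (Q c) (hP c)).symm⟩⟩

/-- Both directions are needed: one makes `Y` preserve cartesian modules, the other shows that the
module representing a cartesian locally flat one is cartesian. -/
theorem isCartesian_yonedaFP_iff (M : RingMod R) :
    AddRep.RightMod.IsCartesian (fpRep R) ((yonedaFP R).obj M) ↔ RingMod.IsCartesian R M :=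
  forall_congr' fun _ => forall_congr' fun _ => forall_congr' fun α =>
    isIso_adjointHom_yonedaSemi_iff (M.map α)

/-- Being cartesian is invariant under isomorphism. -/
theorem isCartesian_of_iso {S : AddRep.{w, v} C} {P Q : S.RightMod} (i : P ≅ Q)
    (hP : AddRep.RightMod.IsCartesian S P) : AddRep.RightMod.IsCartesian S Q := by
  intro c d α
  let ι (c : C) : P.obj c ≅ Q.obj c :=
    { hom := i.hom.app c
      inv := i.inv.app c
      hom_inv_id := congrFun (congrArg AddRep.RightMod.Hom.app i.hom_inv_id) c
      inv_hom_id := congrFun (congrArg AddRep.RightMod.Hom.app i.inv_hom_id) c }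
  exact isIso_adjointHom_of_iso (S.map α) (P.map α) (Q.map α) (ι c) (ι d) (i.hom.comm α) (hP α)

end Levelwise

end CartRep

end

/-! ### The representation theorem. -/

theorem theorem4p13 {C : Type u₁} [Category.{v₁} C] (R : C ⥤ RingCat.{u}) :
    -- `Y` induces an equivalence `Mod-R ≌ L.Flat(Mod-R_fp)`
    (∃ h : ∀ M : CartRep.RingMod R,
        CartRep.AddRep.RightMod.IsLocallyFlat (CartRep.fpRep R) ((CartRep.yonedaFP R).obj M),
      ((CartRep.AddRep.RightMod.IsLocallyFlat (CartRep.fpRep R)).lift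
        (CartRep.yonedaFP R) h).IsEquivalence) ∧
    -- `Y` induces an equivalence `Mod_cart(R) ≌ L.Flat(Mod_cart(R_fp))`
    (∃ h : ∀ M : (CartRep.RingMod.IsCartesian R).FullSubcategory,
        (CartRep.AddRep.RightMod.IsCartesian (CartRep.fpRep R) ⊓
          CartRep.AddRep.RightMod.IsLocallyFlat (CartRep.fpRep R))
            ((CartRep.yonedaFP R).obj M.obj),
      ((CartRep.AddRep.RightMod.IsCartesian (CartRep.fpRep R) ⊓
          CartRep.AddRep.RightMod.IsLocallyFlat (CartRep.fpRep R)).lift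
        ((CartRep.RingMod.IsCartesian R).ι ⋙ CartRep.yonedaFP R) h).IsEquivalence) := by
  refine ⟨⟨CartRep.isLocallyFlat_yonedaFP, ?_⟩,
    ⟨fun M => ⟨(CartRep.isCartesian_yonedaFP_iff M.obj).2 M.property,
      CartRep.isLocallyFlat_yonedaFP M.obj⟩, ?_⟩⟩
  · refine { faithful := inferInstance, full := inferInstance, essSurj := ⟨fun P => ?_⟩ }
    obtain ⟨M, ⟨i⟩⟩ := CartRep.exists_iso_yonedaFP P.obj P.property
    exact ⟨M, ⟨ObjectProperty.isoMk _ i⟩⟩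
  · refine { faithful := inferInstance, full := inferInstance, essSurj := ⟨fun P => ?_⟩ }
    obtain ⟨M, ⟨i⟩⟩ := CartRep.exists_iso_yonedaFP P.obj P.property.2
    -- The module `M` is only known to represent `P`. Being cartesian passes from `P` to `Y(M)`
    -- along the isomorphism, and `Y` reflects it.
    have hM := (CartRep.isCartesian_yonedaFP_iff M).1
      (CartRep.isCartesian_of_iso i.symm P.property.1)
    exact ⟨⟨M, hM⟩, ⟨ObjectProperty.isoMk _ i⟩⟩
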